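/- **Setting.** Let $\Omega\subseteq\mathbb R^n$ be open and $L=-\operatorname{div}(a(x)\nabla)+c(x)$ on $L^2(\Omega,dx)$, where $a$ is bounded, measurable, symmetric and uniformly elliptic, $c\in L^\infty_{loc}(\Omega)$, and $L$ has (for the boundary conditions considered) eigenvalues $\lambda_k\ge 0$ and real eigenfunctions $\phi_k$, $k\ge0$, with $L\phi_k=\lambda_k\phi_k$ weakly in $\Omega$ and $\{\phi_k\}$ an orthonormal basis of $L^2(\Omega)$. Put $u_k=\int u\,\phi_k$, $\operatorname{Dom}(L)=\{u\in L^2:\sum\lambda_k|u_k|^2<\infty\}$ and $\langle Lu,v\rangle=\sum_k\lambda_ku_kv_k$. More generally, for a nonnegative operator with discrete spectrum on some $L^2(\Omega,d\eta)$ and $0\le s\le1$, the power $H^s=(\partial_t+L)^s$ is defined by $$\operatorname{Dom}(H^s)=\Big\{u\in L^2(\mathbb R\times\Omega,dt\,d\eta):\int_{\mathbb R}\sum_k|i\rho+\lambda_k|^s|\widehat{u_k}(\rho)|^2d\rho<\infty\Big\},\qquad \langle H^su,v\rangle=\int_{\mathbb R}\sum_k(i\rho+\lambda_k)^s\,\widehat{u_k}(\rho)\overline{\widehat{v_k}(\rho)}\,d\rho,$$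 for $u,v\in\operatorname{Dom}(H^s)$, where $u_k(t)=\int_\Omega u(t,x)\phi_k(x)\,d\eta(x)$, the hat is the Fourier transform in $t$, and the power is the principal one. A solution to $H^su=0$ in an open $R\subseteq\mathbb R\times\Omega$ is a $u\in\operatorname{Dom}(H^s)$ with $\langle H^su,v\rangle=0$ for all $v\in C^\infty_c(R)\cap\operatorname{Dom}(H^s)$. Let $h:\Omega\to\widetilde\Omega$ be a $C^\infty$ diffeomorphism onto an open $\widetilde\Omega\subseteq\mathbb R^n$ and $0<M\in C^\infty(\Omega)$. Set $(U\circ W)\bar u(t,x)=M(x)\bar u(t,h(x))$ and $d\bar\eta=M(h^{-1}(\tilde x))^2J_{h^{-1}}(\tilde x)\,d\tilde x$, $J_{h^{-1}}=|\det\nabla h^{-1}|$. The operator $\bar L=(U\circ W)^{-1}L(U\circ W)$ on $L^2(\widetilde\Omega,d\bar\eta)$ is the one with $\bar u\in\operatorname{Dom}(\bar L)$ iff $(U\circ W)\bar u\in\operatorname{Dom}(L)$ and $\langle\bar L\bar u,\bar v\rangle=\langle L(U\circ W)\bar u,(U\circ W)\bar v\rangle$. **Properties.** Let $0<s<1$.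 * *Interior Harnack for $H^s$.* For every open $O\subseteq\Omega$ and compact $J\subseteq O$ there is $C>0$ such that every real solution $u$ to $H^su=0$ in $(0,1)\times O$, $u\ge0$ in $(-\infty,1)\times\Omega$ (taken continuous in $(0,1)\times O$) satisfies $\sup_{(1/4,1/2)\times J}u\le C\inf_{(3/4,1)\times J}u$. * *$\alpha$-Hölder estimate for $H^s$*, $0<\alpha<1$. For every open $O\subseteq\Omega$ and compact $K\subset(0,1)\times O$ there is $C$ such that every solution $u$ to $H^su=0$ in $(0,1)\times O$ is, up to modification on a null set, continuous in $(0,1)\times O$ with $\|u\|_{C^{\alpha/2,\alpha}_{t,x}(K)}\le C\|u\|_{L^2(\mathbb R\times\Omega,dt\,d\eta)}$. * *Boundary Harnack for $H^s$.* Let $\Omega_0\subseteq\Omega$ be open and $N\subseteq\Omega$ open such that near each point of $\partial\Omega_0\cap N$ the set $\Omega_0$ is, up to a rotation, the region above the graph of a Lipschitz function; let $N'$ be open with compact closure contained in $N$ and $N'\cap\partial\Omega_0\ne\emptyset$; let $1<t_0<2$ and $x_0\in\Omega_0\cap N$. Then there is $C>0$ such that every real solution $u$ to $H^su=0$ in $(-2,2)\times(\Omega_0\cap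 N)$ with $u\ge0$ in $(-\infty,2)\times\Omega$ which (taken continuous in $(-2,2)\times(\Omega_0\cap N)$) vanishes continuously on $(-2,2)\times((\Omega\setminus\Omega_0)\cap N)$ satisfies $\sup_{(-1,1)\times(\Omega_0\cap N')}u\le C\,u(t_0,x_0)$. The case $O=B_{2r}$, $J=\overline{B_r}$, and the case $N=B_{2r}(\tilde x)$, $N'=B_r(\tilde x)$, $\tilde x\in\partial\Omega_0$, are the classical ball versions. **Theorem (Transference method).** $\bar L$ is a nonnegative operator with discrete spectrum: $\bar\phi_k=\frac{1}{M\circ h^{-1}}\,\phi_k\circ h^{-1}$ is an orthonormal basis of $L^2(\widetilde\Omega,d\bar\eta)$ of eigenfunctions with eigenvalues $\lambda_k$. For every choice of orthonormal eigenbasis of $\bar L$, and $\bar H=\partial_t+\bar L$: 1. $U\circ W:L^2(\mathbb R\times\widetilde\Omega,dt\,d\bar\eta)\to L^2(\mathbb R\times\Omega)$ is an isometry, with $\bar u\in L^2(\mathbb R\times\widetilde\Omega,dt\,d\bar\eta)$ iff $(U\circ W)\bar u\in L^2(\mathbb R\times\Omega)$, and for $0\le s\le1$, $\bar H^s=(U\circ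 W)^{-1}H^s(U\circ W)$, that is, $\bar u\in\operatorname{Dom}(\bar H^s)$ iff $(U\circ W)\bar u\in\operatorname{Dom}(H^s)$, and $\langle\bar H^s\bar u,\bar v\rangle=\langle H^s(U\circ W)\bar u,(U\circ W)\bar v\rangle$ for $\bar u,\bar v\in\operatorname{Dom}(\bar H^s)$. 2. For $0<s<1$: if the interior Harnack inequality holds for $H^s$, it holds for $\bar H^s$ (on open subsets of $\widetilde\Omega$); if the $\alpha$-Hölder estimate holds for $H^s$, it holds for $\bar H^s$ with the same $\alpha$; if the boundary Harnack inequality holds for $H^s$, it holds for $\bar H^s$. The same is true if, in all three properties for both operators, solutions are in addition normalised to have zero mean, that is, no component in the null space of the spatial operator. -/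

import Mathlib

open MeasureTheory Set
open scoped ENNReal NNReal ContDiff FourierTransform

noncomputable section

/-- The Fourier transform of a function in `L²(ℝ; ℂ)`, normalised as
`ĝ(ρ) = (2π)^(-1/2) ∫ g(t) e^(-iρt) dt` and extended from `L¹ ∩ L²` to `L²` by Plancherel's theorem
(Mathlib's transform has the phase `e^(-2πi t ξ)`, so `ξ = ρ / (2π)`). -/
def l2Fourier (g : ℝ → ℂ) (ρ : ℝ) : ℂ := by
  classical
  exact if hg : MemLp g 2 (volume : Measure ℝ) then
    (((Real.sqrt (2 * Real.pi))⁻¹ : ℝ) : ℂ) *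
      ((𝓕 (hg.toLp g) : Lp ℂ 2 (volume : Measure ℝ)) : ℝ → ℂ) (ρ / (2 * Real.pi))
  else 0

/-- A nonnegative linear operator with discrete spectrum on `L²(Ω, dη)`, `Ω ⊆ ℝⁿ` open, given by its
eigenvalues and an orthonormal basis of (real) eigenfunctions. -/
structure DiscreteOp (n : ℕ) where
  Ω : Set (EuclideanSpace ℝ (Fin n))
  isOpen : IsOpen Ω
  η : Measure (EuclideanSpace ℝ (Fin n))
  eigval : ℕ → ℝ
  eigfun : ℕ → EuclideanSpace ℝ (Fin n) → ℝ
  eigval_nonneg : ∀ k, 0 ≤ eigval k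
  memLp : ∀ k, MemLp (eigfun k) 2 η
  orthonormal : ∀ k l, ∫ x, eigfun k x * eigfun l x ∂η = if k = l then 1 else 0
  complete : ∀ f : EuclideanSpace ℝ (Fin n) → ℝ, MemLp f 2 η →
    (∀ k, ∫ x, f x * eigfun k x ∂η = 0) → f =ᵐ[η] 0

namespace DiscreteOp

variable {n : ℕ}

/-- `f_k = ∫ f φ_k dη`. -/
def coeff (L : DiscreteOp n) (f : EuclideanSpace ℝ (Fin n) → ℝ) (k : ℕ) : ℝ :=
  ∫ x, f x * L.eigfun k x ∂L.η

/-- `Dom(L) = {f ∈ L²(Ω, dη) : ∑ λ_k |f_k|² < ∞}`. -/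
def MemDom (L : DiscreteOp n) (f : EuclideanSpace ℝ (Fin n) → ℝ) : Prop :=
  MemLp f 2 L.η ∧ Summable fun k => L.eigval k * L.coeff f k ^ 2

/-- `⟨L f, g⟩ = ∑ λ_k f_k g_k`, for `f, g ∈ Dom(L)`. -/
def form (L : DiscreteOp n) (f g : EuclideanSpace ℝ (Fin n) → ℝ) : ℝ :=
  ∑' k, L.eigval k * L.coeff f k * L.coeff g k

/-- `u_k(t) = ∫ u(t, x) φ_k(x) dη(x)`. -/
def tcoeff (L : DiscreteOp n) (u : ℝ × EuclideanSpace ℝ (Fin n) → ℂ) (k : ℕ) (t : ℝ) : ℂ :=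
  ∫ x, u (t, x) * (L.eigfun k x : ℂ) ∂L.η

/-- The measure `dt dη` on `ℝ × Ω`. -/
def stMeasure (L : DiscreteOp n) : Measure (ℝ × EuclideanSpace ℝ (Fin n)) :=
  (volume : Measure ℝ).prod L.η

/-- `Dom(H^s)` for `H = ∂_t + L`: the `u ∈ L²(ℝ × Ω, dt dη)` with
`∫ ∑_k |iρ + λ_k|^s |û_k(ρ)|² dρ < ∞`. -/
def MemDomH (L : DiscreteOp n) (s : ℝ) (u : ℝ × EuclideanSpace ℝ (Fin n) → ℂ) : Prop :=
  MemLp u 2 L.stMeasure ∧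
    ∫⁻ ρ : ℝ, ∑' k, ENNReal.ofReal
      (‖Complex.I * (ρ : ℂ) + (L.eigval k : ℂ)‖ ^ s * ‖l2Fourier (L.tcoeff u k) ρ‖ ^ 2) < ⊤

/-- `⟨H^s u, v⟩ = ∫ ∑_k (iρ + λ_k)^s û_k(ρ) conj(v̂_k(ρ)) dρ`, for `u, v ∈ Dom(H^s)`, with the
principal branch of the power. -/
def pairH (L : DiscreteOp n) (s : ℝ) (u v : ℝ × EuclideanSpace ℝ (Fin n) → ℂ) : ℂ :=
  ∫ ρ : ℝ, ∑' k, (Complex.I * (ρ : ℂ) + (L.eigval k : ℂ)) ^ (s : ℂ) *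
    l2Fourier (L.tcoeff u k) ρ * (starRingEnd ℂ) (l2Fourier (L.tcoeff v k) ρ)

/-- The normalisation "zero spatial mean": no component in the null space of `L`
(void if all eigenvalues are positive). -/
def ZeroMean (L : DiscreteOp n) (u : ℝ × EuclideanSpace ℝ (Fin n) → ℂ) : Prop :=
  ∀ k, L.eigval k = 0 → ∀ᵐ t : ℝ, L.tcoeff u k t = 0

/-- `u ∈ Dom(H^s)` is a weak solution to `H^s u = 0` in the open set `R ⊆ ℝ × Ω`.
If `zm` holds, then `u` is moreover normalised to have zero mean. -/
def IsSolution (L : DiscreteOp n) (zm : Prop) (s : ℝ) (R : Set (ℝ × EuclideanSpace ℝ (Fin n)))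
    (u : ℝ × EuclideanSpace ℝ (Fin n) → ℂ) : Prop :=
  L.MemDomH s u ∧ (zm → L.ZeroMean u) ∧
    ∀ v : ℝ × EuclideanSpace ℝ (Fin n) → ℂ, ContDiff ℝ ∞ v → HasCompactSupport v →
      tsupport v ⊆ R → L.MemDomH s v → L.pairH s u v = 0

/-- `u ≥ 0` in `(-∞, T) × Ω`. -/
def NonnegBefore (L : DiscreteOp n) (T : ℝ) (u : ℝ × EuclideanSpace ℝ (Fin n) → ℝ) : Prop :=
  ∀ᵐ p : ℝ × EuclideanSpace ℝ (Fin n), p.1 < T → p.2 ∈ L.Ω → 0 ≤ u p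

end DiscreteOp

/-- The parabolic Hölder norm `‖v‖_{C^{α/2,α}_{t,x}(K)}`: the sup norm plus the Hölder seminorm. -/
def parabolicHolderNorm {n : ℕ} (α : ℝ) (K : Set (ℝ × EuclideanSpace ℝ (Fin n)))
    (v : ℝ × EuclideanSpace ℝ (Fin n) → ℂ) : ℝ≥0∞ :=
  (⨆ p ∈ K, ‖v p‖ₑ) + ⨆ p ∈ K, ⨆ q ∈ K,
    ‖v p - v q‖ₑ / ENNReal.ofReal (|p.1 - q.1| ^ (α / 2) + ‖p.2 - q.2‖ ^ α)

/-- Inside the open set `N` the set `Ω₀` has Lipschitz boundary: near each point of `∂Ω₀ ∩ N` it is,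
up to a rotation, the region above the graph of a Lipschitz function of the variables orthogonal
to a unit vector `e` (so `∂Ω₀` is the graph there). -/
def HasLipschitzBoundaryIn {n : ℕ} (Ω₀ N : Set (EuclideanSpace ℝ (Fin n))) : Prop :=
  ∀ z ∈ frontier Ω₀ ∩ N, ∃ (ε : ℝ) (e : EuclideanSpace ℝ (Fin n)) (κ : ℝ≥0)
    (g : EuclideanSpace ℝ (Fin n) → ℝ), 0 < ε ∧ ‖e‖ = 1 ∧ LipschitzWith κ g ∧
      ∀ x ∈ Metric.ball z ε, x ∈ Ω₀ ↔ g (x - inner ℝ e x • e) < inner ℝ e x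

namespace DiscreteOp

variable {n : ℕ}

/-- Parabolic interior Harnack inequality for `H^s`, on open sets `O ⊆ Ω` and compact `J ⊆ O`
(for instance `O = B_{2r}` and `J` the closure of `B_r`):
`sup_{(1/4,1/2) × J} u ≤ C inf_{(3/4,1) × J} u` for nonnegative solutions in `(0,1) × O`.
An element `u` of `Dom(H^s)` is represented by its continuous version in `(0,1) × O`. -/
def InteriorHarnack (L : DiscreteOp n) (zm : Prop) (s : ℝ) : Prop :=
  ∀ O J : Set (EuclideanSpace ℝ (Fin n)), IsOpen O → O ⊆ L.Ω → IsCompact J → J ⊆ O →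
    ∃ C : ℝ, 0 < C ∧ ∀ u : ℝ × EuclideanSpace ℝ (Fin n) → ℝ,
      L.IsSolution zm s (Ioo 0 1 ×ˢ O) (fun p => (u p : ℂ)) → L.NonnegBefore 1 u →
      ContinuousOn u (Ioo 0 1 ×ˢ O) →
      ∀ p ∈ Ioo (1 / 4 : ℝ) (1 / 2) ×ˢ J, ∀ q ∈ Ioo (3 / 4 : ℝ) 1 ×ˢ J, u p ≤ C * u q

/-- Local boundedness and parabolic `α`-Hölder continuity of solutions: a solution in
`R = (0,1) × O` has a version that is continuous in `R` and satisfies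
`‖u‖_{C^{α/2,α}(K)} ≤ C ‖u‖_{L²(ℝ × Ω)}` on compact `K ⊆ R`, `C` independent of `u`. -/
def InteriorHolder (L : DiscreteOp n) (zm : Prop) (s α : ℝ) : Prop :=
  ∀ O : Set (EuclideanSpace ℝ (Fin n)), IsOpen O → O ⊆ L.Ω →
    ∀ K : Set (ℝ × EuclideanSpace ℝ (Fin n)), IsCompact K → K ⊆ Ioo 0 1 ×ˢ O →
      ∃ C : ℝ≥0, ∀ u : ℝ × EuclideanSpace ℝ (Fin n) → ℂ, L.IsSolution zm s (Ioo 0 1 ×ˢ O) u →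
        ∃ v : ℝ × EuclideanSpace ℝ (Fin n) → ℂ, v =ᵐ[L.stMeasure] u ∧
          ContinuousOn v (Ioo 0 1 ×ˢ O) ∧
          parabolicHolderNorm α K v ≤ C * eLpNorm u 2 L.stMeasure

/-- Parabolic boundary Harnack inequality for `H^s`, for `Ω₀ ⊆ Ω` with Lipschitz boundary inside an
open set `N ⊆ Ω` and an open set `N'` compactly contained in `N` and meeting `∂Ω₀` (for instance
`N = B_{2r}(x̃)`, `N' = B_r(x̃)` with `x̃ ∈ ∂Ω₀`):
`sup_{(-1,1) × (Ω₀ ∩ N')} u ≤ C u(t₀, x₀)` for the solutions in `(-2,2) × (Ω₀ ∩ N)` that are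
nonnegative in `(-∞,2) × Ω` and vanish continuously on `(-2,2) × ((Ω \ Ω₀) ∩ N)`. -/
def BoundaryHarnack (L : DiscreteOp n) (zm : Prop) (s : ℝ) : Prop :=
  ∀ (Ω₀ N N' : Set (EuclideanSpace ℝ (Fin n))) (t₀ : ℝ) (x₀ : EuclideanSpace ℝ (Fin n)),
    IsOpen Ω₀ → Ω₀ ⊆ L.Ω → IsOpen N → N ⊆ L.Ω → IsOpen N' → IsCompact (closure N') →
    closure N' ⊆ N → (frontier Ω₀ ∩ N').Nonempty → HasLipschitzBoundaryIn Ω₀ N →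
    t₀ ∈ Ioo (1 : ℝ) 2 → x₀ ∈ Ω₀ ∩ N →
    ∃ C : ℝ, 0 < C ∧ ∀ u : ℝ × EuclideanSpace ℝ (Fin n) → ℝ,
      L.IsSolution zm s (Ioo (-2) 2 ×ˢ (Ω₀ ∩ N)) (fun p => (u p : ℂ)) → L.NonnegBefore 2 u →
      ContinuousOn u (Ioo (-2) 2 ×ˢ N) →
      (∀ p ∈ Ioo (-2 : ℝ) 2 ×ˢ (N \ Ω₀), u p = 0) →
      ∀ p ∈ Ioo (-1 : ℝ) 1 ×ˢ (Ω₀ ∩ N'), u p ≤ C * u (t₀, x₀)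

end DiscreteOp

/-- `G` is the weak gradient of `f` in `Ω` and belongs to `L²` on compact subsets of `Ω`. -/
def IsWeakGradient {n : ℕ} (Ω : Set (EuclideanSpace ℝ (Fin n)))
    (f : EuclideanSpace ℝ (Fin n) → ℝ)
    (G : EuclideanSpace ℝ (Fin n) → EuclideanSpace ℝ (Fin n)) : Prop :=
  (∀ K : Set (EuclideanSpace ℝ (Fin n)), IsCompact K → K ⊆ Ω → MemLp G 2 (volume.restrict K)) ∧
  ∀ v : EuclideanSpace ℝ (Fin n) → ℝ, ContDiff ℝ ∞ v → HasCompactSupport v → tsupport v ⊆ Ω →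
    ∀ i, ∫ x in Ω, f x * fderiv ℝ v x (EuclideanSpace.single i 1) = - ∫ x in Ω, G x i * v x

/-- `L = -div(a(x)∇) + c(x)` in `Ω` with Lebesgue measure: `a` is bounded, measurable, symmetric and
uniformly elliptic, `c ∈ L^∞_loc(Ω)`, and `L φ_k = λ_k φ_k` in the weak sense. -/
structure IsDivergenceForm {n : ℕ} (L : DiscreteOp n) (Λ : ℝ)
    (a : EuclideanSpace ℝ (Fin n) → Matrix (Fin n) (Fin n) ℝ)
    (c : EuclideanSpace ℝ (Fin n) → ℝ) : Prop where
  measure_eq : L.η = volume.restrict L.Ω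
  Λ_pos : 0 < Λ
  a_meas : ∀ i j, AEMeasurable (fun x => a x i j) (volume.restrict L.Ω)
  a_symm : ∀ᵐ x ∂(volume.restrict L.Ω), (a x).IsSymm
  elliptic : ∀ᵐ x ∂(volume.restrict L.Ω), ∀ ξ : EuclideanSpace ℝ (Fin n),
    Λ⁻¹ * ‖ξ‖ ^ 2 ≤ ∑ i, ∑ j, a x i j * ξ i * ξ j ∧
      ∑ i, ∑ j, a x i j * ξ i * ξ j ≤ Λ * ‖ξ‖ ^ 2
  c_meas : AEMeasurable c (volume.restrict L.Ω)
  c_locBdd : ∀ K : Set (EuclideanSpace ℝ (Fin n)), IsCompact K → K ⊆ L.Ω →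
    ∃ B : ℝ, ∀ᵐ x ∂(volume.restrict K), |c x| ≤ B
  eigen : ∀ k, ∃ G : EuclideanSpace ℝ (Fin n) → EuclideanSpace ℝ (Fin n),
    IsWeakGradient L.Ω (L.eigfun k) G ∧
    ∀ v : EuclideanSpace ℝ (Fin n) → ℝ, ContDiff ℝ ∞ v → HasCompactSupport v →
      tsupport v ⊆ L.Ω →
      (∫ x in L.Ω, ∑ i, ∑ j, a x i j * G x i * fderiv ℝ v x (EuclideanSpace.single j 1)) +
        ∫ x in L.Ω, c x * L.eigfun k x * v x = L.eigval k * ∫ x in L.Ω, L.eigfun k x * v x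

/-- `h : Ω → Ω'` is a smooth change of variables (a smooth diffeomorphism) with inverse `k`. -/
structure IsSmoothChange {n : ℕ} (Ω Ω' : Set (EuclideanSpace ℝ (Fin n)))
    (h k : EuclideanSpace ℝ (Fin n) → EuclideanSpace ℝ (Fin n)) : Prop where
  isOpen : IsOpen Ω'
  mapsTo : MapsTo h Ω Ω'
  mapsTo_inv : MapsTo k Ω' Ω
  invOn : InvOn k h Ω Ω'
  smooth : ContDiffOn ℝ ∞ h Ω
  smooth_inv : ContDiffOn ℝ ∞ k Ω'

/-- `(U ∘ W) f (x) = M(x) f(h(x))`. -/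
def transfer {n : ℕ} (M : EuclideanSpace ℝ (Fin n) → ℝ)
    (h : EuclideanSpace ℝ (Fin n) → EuclideanSpace ℝ (Fin n))
    (f : EuclideanSpace ℝ (Fin n) → ℝ) (x : EuclideanSpace ℝ (Fin n)) : ℝ :=
  M x * f (h x)

/-- `(U ∘ W) u (t, x) = M(x) u(t, h(x))`. -/
def transferT {n : ℕ} (M : EuclideanSpace ℝ (Fin n) → ℝ)
    (h : EuclideanSpace ℝ (Fin n) → EuclideanSpace ℝ (Fin n))
    (u : ℝ × EuclideanSpace ℝ (Fin n) → ℂ) (p : ℝ × EuclideanSpace ℝ (Fin n)) : ℂ :=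
  (M p.2 : ℂ) * u (p.1, h p.2)

/-- The measure `M(h⁻¹(y))² J_{h⁻¹}(y) dy` on `Ω'`, where `k = h⁻¹` and `J_k = |det ∇k|`. -/
def transferMeasure {n : ℕ} (Ω' : Set (EuclideanSpace ℝ (Fin n)))
    (M : EuclideanSpace ℝ (Fin n) → ℝ)
    (k : EuclideanSpace ℝ (Fin n) → EuclideanSpace ℝ (Fin n)) :
    Measure (EuclideanSpace ℝ (Fin n)) :=
  (volume.restrict Ω').withDensity fun y =>
    ENNReal.ofReal (M (k y) ^ 2 * |(fderiv ℝ k y).det|)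

/-- `L' = (U ∘ W)⁻¹ ∘ L ∘ (U ∘ W)` on `L²(Ω', M(h⁻¹)² J_{h⁻¹} dy)`: its domain consists of the `f`
with `(U ∘ W) f ∈ Dom(L)`, and `⟨L' f, g⟩ = ⟨L (U ∘ W) f, (U ∘ W) g⟩`. -/
structure IsConjugate {n : ℕ} (L L' : DiscreteOp n) (Ω' : Set (EuclideanSpace ℝ (Fin n)))
    (M : EuclideanSpace ℝ (Fin n) → ℝ)
    (h k : EuclideanSpace ℝ (Fin n) → EuclideanSpace ℝ (Fin n)) : Prop where
  domain_eq : L'.Ω = Ω'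
  measure_eq : L'.η = transferMeasure Ω' M k
  memDom_iff : ∀ f, L'.MemDom f ↔ L.MemDom (transfer M h f)
  form_eq : ∀ f g, L'.MemDom f → L'.MemDom g →
    L'.form f g = L.form (transfer M h f) (transfer M h g)

end

/-! The map `f ↦ M · (f ∘ h)` is a unitary from the weighted space over `Ω'` onto the unweighted
`L²` over `Ω`: by the Jacobian formula `k = h⁻¹` pushes the weighted measure forward to `M² dx`
(`IsSmoothChange.isWeightedChange`). It sends `φ_j ∘ k / M ∘ k` to `φ_j`, so expanding in these
functions over `Ω'` gives the same coefficients as expanding the transferred function in the `φ_j`.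
For this eigenbasis (`transferOp`) every identity for `H^s` is immediate.

An arbitrary resolution `L'` of the conjugated operator only shares the form with `transferOp`.
Evaluating the form on one eigenfunction from each resolution shows that eigenfunctions with
different eigenvalues are orthogonal (`SameForm.eigval_eq`), so the two functional calculi coincide.
To use this for `H^s`, the time Fourier transform is taken of the `L²`-valued function `t ↦ u(t,
·)`: for almost every `ρ` the numbers `û_j(ρ)` are then the coefficients of one vector `V ρ`,
whatever the basis (`exists_l2Fourier_tcoeff_eq_inner`). Energy and pairing at frequency `ρ` involve
the function `x ↦ (iρ + x)^(s/2)` of the operator applied to `V ρ`, hence do not depend on the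
basis.

Solutions go to solutions because test functions pull back to test functions
(`isSolution_transferT`). The estimates then transfer because `M`, `1/M` are bounded and `k`, `1/(M
∘ k)` are Lipschitz on compact sets. Boundary Harnack also needs invariance of Lipschitz boundaries
under diffeomorphisms; this goes through cones: being above a Lipschitz graph gives a cone
condition, cone conditions survive maps with invertible strict derivative, and a cone condition
gives back a Lipschitz graph. -/

/-! ### Weighted changes of variables between measure spaces. -/

section WeightedChange

variable {X X' : Type*} [MeasurableSpace X] [MeasurableSpace X']

/-- `h` is an almost everywhere invertible change of variables, with inverse `k`, carrying the
measure `m² dμ` to `μ'`. -/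
structure IsWeightedChange (μ : Measure X) (μ' : Measure X') (m : X → ℝ) (h : X → X')
    (k : X' → X) : Prop where
  aemeasurable : AEMeasurable h μ
  aemeasurable_inv : AEMeasurable k μ'
  right_inv : ∀ᵐ y ∂μ', h (k y) = y
  left_inv : ∀ᵐ x ∂μ, k (h x) = x
  weight_aemeasurable : AEMeasurable m μ
  weight_pos : ∀ᵐ x ∂μ, 0 < m x
  map_inv : μ'.map k = μ.withDensity fun x => ENNReal.ofReal (m x ^ 2)

theorem map_withDensity_comp {μ : Measure X} {k : X → X'} (hk : AEMeasurable k μ)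
    {f : X' → ℝ≥0∞} (hf : AEMeasurable f (μ.map k)) :
    (μ.withDensity fun x => f (k x)).map k = (μ.map k).withDensity f := by
  have hfk : AEMeasurable (fun x => f (k x)) μ := hf.comp_aemeasurable hk
  refine Measure.ext_of_lintegral _ fun φ hφ => ?_
  have hk' : AEMeasurable k (μ.withDensity fun x => f (k x)) :=
    hk.mono_ac (withDensity_absolutelyContinuous _ _)
  rw [lintegral_map' hφ.aemeasurable hk',
    show ∫⁻ x, φ (k x) ∂(μ.withDensity fun x => f (k x)) = _ from
      lintegral_withDensity_eq_lintegral_mul₀ hfk (hφ.comp_aemeasurable hk),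
    lintegral_withDensity_eq_lintegral_mul₀ hf hφ.aemeasurable,
    lintegral_map' (hf.mul hφ.aemeasurable) hk]
  rfl

theorem prod_map_map_of_aemeasurable {X₁ X₂ : Type*} [MeasurableSpace X₁] [MeasurableSpace X₂]
    (τ : Measure X₂) [SFinite τ] (μ : Measure X) [SFinite μ] {k : X → X₁} (hk : AEMeasurable k μ) :
    τ.prod (μ.map k) = (τ.prod μ).map (Prod.map id k) := by
  have h1 : Prod.map id k =ᵐ[τ.prod μ] Prod.map id (hk.mk k) := by
    filter_upwards [Measure.quasiMeasurePreserving_snd.ae hk.ae_eq_mk] with p hp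
    simp [Prod.map, hp]
  rw [Measure.map_congr hk.ae_eq_mk, Measure.map_congr h1,
    ← Measure.map_prod_map _ _ measurable_id hk.measurable_mk, Measure.map_id]

namespace IsWeightedChange

variable {μ : Measure X} {μ' : Measure X'} {m : X → ℝ} {h : X → X'} {k : X' → X}

theorem density_aemeasurable (H : IsWeightedChange μ μ' m h k) :
    AEMeasurable (fun x => ENNReal.ofReal (m x ^ 2)) μ :=
  (H.weight_aemeasurable.pow_const 2).ennreal_ofReal

theorem ac_density (H : IsWeightedChange μ μ' m h k) :
    μ ≪ μ.withDensity fun x => ENNReal.ofReal (m x ^ 2) := by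
  refine withDensity_absolutelyContinuous' H.density_aemeasurable ?_
  filter_upwards [H.weight_pos] with x hx
  simpa using hx.ne'

theorem density_ac (_ : IsWeightedChange μ μ' m h k) :
    (μ.withDensity fun x => ENNReal.ofReal (m x ^ 2)) ≪ μ :=
  withDensity_absolutelyContinuous _ _

theorem map_inv_ac (H : IsWeightedChange μ μ' m h k) : μ'.map k ≪ μ :=
  H.map_inv ▸ H.density_ac

theorem map_density (H : IsWeightedChange μ μ' m h k) :
    (μ.withDensity fun x => ENNReal.ofReal (m x ^ 2)).map h = μ' := by
  have h1 : AEMeasurable h (μ'.map k) := H.aemeasurable.mono_ac H.map_inv_ac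
  rw [← H.map_inv, AEMeasurable.map_map_of_aemeasurable h1 H.aemeasurable_inv]
  have h2 : h ∘ k =ᵐ[μ'] id := H.right_inv
  rw [Measure.map_congr h2, Measure.map_id]

/-- Since `m > 0` almost everywhere, `μ` and `m² μ` have the same null sets, and `h` carries `m² μ`
to `μ'`. -/
theorem map_ac (H : IsWeightedChange μ μ' m h k) : μ.map h ≪ μ' := by
  intro s hs
  rw [← H.map_density] at hs
  have h1 : AEMeasurable h (μ.withDensity fun x => ENNReal.ofReal (m x ^ 2)) :=
    H.aemeasurable.mono_ac H.density_ac
  have h2 := ae_of_ae_map h1 (measure_eq_zero_iff_ae_notMem.1 hs)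
  obtain ⟨t, hst, ht, ht0⟩ := exists_measurable_superset_of_null hs
  refine measure_mono_null hst ?_
  rw [Measure.map_apply_of_aemeasurable H.aemeasurable ht]
  rw [Measure.map_apply_of_aemeasurable h1 ht] at ht0
  exact H.ac_density ht0

theorem ae_of_ae (H : IsWeightedChange μ μ' m h k) {P : X' → Prop} (hP : ∀ᵐ y ∂μ', P y) :
    ∀ᵐ x ∂μ, P (h x) :=
  ae_of_ae_map H.aemeasurable (H.map_ac.ae_le hP)

theorem ae_inv_of_ae (H : IsWeightedChange μ μ' m h k) {P : X → Prop} (hP : ∀ᵐ x ∂μ, P x) :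
    ∀ᵐ y ∂μ', P (k y) :=
  ae_of_ae_map H.aemeasurable_inv (H.map_inv_ac.ae_le hP)

theorem ae_iff (H : IsWeightedChange μ μ' m h k) {P : X' → Prop} :
    (∀ᵐ x ∂μ, P (h x)) ↔ ∀ᵐ y ∂μ', P y := by
  refine ⟨fun hP => ?_, H.ae_of_ae⟩
  filter_upwards [H.ae_inv_of_ae hP, H.right_inv] with y h1 h2
  rwa [h2] at h1

theorem aestronglyMeasurable_comp_iff (H : IsWeightedChange μ μ' m h k) {F : Type*}
    [NormedAddCommGroup F] {u : X' → F} :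
    AEStronglyMeasurable (fun x => u (h x)) μ ↔ AEStronglyMeasurable u μ' := by
  constructor
  · intro hu
    refine ((hu.mono_ac H.map_inv_ac).comp_aemeasurable H.aemeasurable_inv).congr ?_
    filter_upwards [H.right_inv] with y hy
    simp [hy]
  · intro hu
    exact (hu.mono_ac H.map_ac).comp_aemeasurable H.aemeasurable

variable {F : Type*} [NormedAddCommGroup F] [NormedSpace ℝ F]

theorem aestronglyMeasurable_iff (H : IsWeightedChange μ μ' m h k) {u : X' → F} :
    AEStronglyMeasurable (fun x => m x • u (h x)) μ ↔ AEStronglyMeasurable u μ' := by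
  rw [← H.aestronglyMeasurable_comp_iff]
  constructor
  · intro hu
    refine (H.weight_aemeasurable.inv.aestronglyMeasurable.smul hu).congr ?_
    filter_upwards [H.weight_pos] with x hx
    simp [smul_smul, inv_mul_cancel₀ hx.ne']
  · exact fun hu => H.weight_aemeasurable.aestronglyMeasurable.smul hu

theorem lintegral_eq (H : IsWeightedChange μ μ' m h k) {g : X' → ℝ≥0∞} (hg : AEMeasurable g μ') :
    ∫⁻ y, g y ∂μ' = ∫⁻ x, ENNReal.ofReal (m x ^ 2) * g (h x) ∂μ := by
  have h1 : AEMeasurable h (μ.withDensity fun x => ENNReal.ofReal (m x ^ 2)) :=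
    H.aemeasurable.mono_ac H.density_ac
  have hgh : AEMeasurable (fun x => g (h x)) μ :=
    (hg.mono_ac H.map_ac).comp_aemeasurable H.aemeasurable
  conv_lhs => rw [← H.map_density]
  rw [lintegral_map' (by rwa [H.map_density]) h1,
    lintegral_withDensity_eq_lintegral_mul₀ H.density_aemeasurable hgh]
  rfl

/-- No regularity of `g` is required, so the coefficient identities below hold for arbitrary
functions, without an `L²` assumption. -/
theorem integral_eq (H : IsWeightedChange μ μ' m h k) (g : X' → F) :
    ∫ y, g y ∂μ' = ∫ x, (m x ^ 2) • g (h x) ∂μ := by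
  have h1 : AEMeasurable h (μ.withDensity fun x => ENNReal.ofReal (m x ^ 2)) :=
    H.aemeasurable.mono_ac H.density_ac
  have key : ∫ x, g (h x) ∂(μ.withDensity fun x => ENNReal.ofReal (m x ^ 2)) =
      ∫ x, (m x ^ 2) • g (h x) ∂μ := by
    rw [integral_withDensity_eq_integral_toReal_smul₀ H.density_aemeasurable
      (Filter.Eventually.of_forall fun x => ENNReal.ofReal_lt_top)]
    simp [ENNReal.toReal_ofReal, sq_nonneg]
  rw [← key]
  by_cases hg : AEStronglyMeasurable g μ'
  · conv_lhs => rw [← H.map_density]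
    rw [integral_map h1 (by rwa [H.map_density])]
  -- Measurability fails on both sides at once, and both integrals take the default value zero.
  · rw [integral_non_aestronglyMeasurable hg, integral_non_aestronglyMeasurable]
    exact fun hc => hg (H.aestronglyMeasurable_comp_iff.1 (hc.mono_ac H.ac_density))

theorem eLpNorm_eq (H : IsWeightedChange μ μ' m h k) {u : X' → F}
    (hu : AEStronglyMeasurable u μ') :
    eLpNorm (fun x => m x • u (h x)) 2 μ = eLpNorm u 2 μ' := by
  rw [eLpNorm_eq_lintegral_rpow_enorm_toReal (by norm_num) (by norm_num),
    eLpNorm_eq_lintegral_rpow_enorm_toReal (by norm_num) (by norm_num),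
    H.lintegral_eq (hu.enorm.pow_const _)]
  congr 1
  refine lintegral_congr fun x => ?_
  rw [enorm_smul, ENNReal.mul_rpow_of_nonneg _ _ (by norm_num)]
  congr 1
  rw [← sq_abs, ENNReal.ofReal_pow (abs_nonneg _), ← Real.norm_eq_abs, ofReal_norm]
  norm_num

theorem memLp_iff (H : IsWeightedChange μ μ' m h k) {u : X' → F} :
    MemLp (fun x => m x • u (h x)) 2 μ ↔ MemLp u 2 μ' := by
  constructor
  · intro hu
    have h1 := H.aestronglyMeasurable_iff.1 hu.1
    exact ⟨h1, H.eLpNorm_eq h1 ▸ hu.2⟩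
  · intro hu
    exact ⟨H.aestronglyMeasurable_iff.2 hu.1, (H.eLpNorm_eq hu.1).symm ▸ hu.2⟩

theorem prod (H : IsWeightedChange μ μ' m h k) [SFinite μ] [SFinite μ'] {T : Type*}
    [MeasurableSpace T] (τ : Measure T) [SFinite τ] :
    IsWeightedChange (τ.prod μ) (τ.prod μ') (fun p => m p.2) (Prod.map id h) (Prod.map id k) where
  aemeasurable := measurable_fst.aemeasurable.prodMk
    (H.aemeasurable.comp_quasiMeasurePreserving Measure.quasiMeasurePreserving_snd)
  aemeasurable_inv := measurable_fst.aemeasurable.prodMk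
    (H.aemeasurable_inv.comp_quasiMeasurePreserving Measure.quasiMeasurePreserving_snd)
  right_inv := by
    filter_upwards [Measure.quasiMeasurePreserving_snd.ae H.right_inv] with p hp
    simp [Prod.map, hp]
  left_inv := by
    filter_upwards [Measure.quasiMeasurePreserving_snd.ae H.left_inv] with p hp
    simp [Prod.map, hp]
  weight_aemeasurable :=
    H.weight_aemeasurable.comp_quasiMeasurePreserving Measure.quasiMeasurePreserving_snd
  weight_pos := Measure.quasiMeasurePreserving_snd.ae H.weight_pos
  map_inv := by
    rw [← prod_map_map_of_aemeasurable _ _ H.aemeasurable_inv, H.map_inv,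
      prod_withDensity_right₀ H.density_aemeasurable]

end IsWeightedChange

end WeightedChange

/-! ### Diffeomorphisms as weighted changes of variables. -/

namespace IsSmoothChange

variable {n : ℕ} {Ω Ω' : Set (EuclideanSpace ℝ (Fin n))}
  {h k : EuclideanSpace ℝ (Fin n) → EuclideanSpace ℝ (Fin n)}

theorem symm (hh : IsSmoothChange Ω Ω' h k) (hΩ : IsOpen Ω) : IsSmoothChange Ω' Ω k h :=
  ⟨hΩ, hh.mapsTo_inv, hh.mapsTo, hh.invOn.symm, hh.smooth_inv, hh.smooth⟩

theorem image_inv (hh : IsSmoothChange Ω Ω' h k) : k '' Ω' = Ω :=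
  (hh.mapsTo_inv.image_subset).antisymm fun x hx => ⟨h x, hh.mapsTo hx, hh.invOn.1 hx⟩

theorem hasFDerivAt (hh : IsSmoothChange Ω Ω' h k) (hΩ : IsOpen Ω)
    {x : EuclideanSpace ℝ (Fin n)} (hx : x ∈ Ω) : HasFDerivAt h (fderiv ℝ h x) x :=
  ((hh.smooth.contDiffAt (hΩ.mem_nhds hx)).differentiableAt (by simp)).hasFDerivAt

theorem fderiv_comp (hh : IsSmoothChange Ω Ω' h k) (hΩ : IsOpen Ω)
    {x : EuclideanSpace ℝ (Fin n)} (hx : x ∈ Ω) :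
    (fderiv ℝ k (h x)).comp (fderiv ℝ h x) = ContinuousLinearMap.id ℝ _ := by
  have h1 := ((hh.symm hΩ).hasFDerivAt hh.isOpen (hh.mapsTo hx)).comp x (hh.hasFDerivAt hΩ hx)
  refine h1.unique ((hasFDerivAt_id x).congr_of_eventuallyEq ?_)
  filter_upwards [hΩ.mem_nhds hx] with y hy
  exact hh.invOn.1 hy

/-- The change of variables formula for `k` pushes `|det Dk| dy` to Lebesgue measure on `Ω`; the
remaining density `M(k y)²` factors through `k` and becomes `M²`. -/
theorem isWeightedChange (hh : IsSmoothChange Ω Ω' h k) (hΩ : IsOpen Ω)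
    {M : EuclideanSpace ℝ (Fin n) → ℝ} (hM : ContDiffOn ℝ ∞ M Ω) (hMpos : ∀ x ∈ Ω, 0 < M x) :
    IsWeightedChange (volume.restrict Ω) (transferMeasure Ω' M k) M h k := by
  have hk : AEMeasurable k (volume.restrict Ω') :=
    hh.smooth_inv.continuousOn.aemeasurable hh.isOpen.measurableSet
  have hac : transferMeasure Ω' M k ≪ volume.restrict Ω' := withDensity_absolutelyContinuous _ _
  have hMm : AEMeasurable M (volume.restrict Ω) :=
    hM.continuousOn.aemeasurable hΩ.measurableSet
  have hsym := hh.symm hΩ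
  have hdet : AEMeasurable (fun y => ENNReal.ofReal |(fderiv ℝ k y).det|)
      (volume.restrict Ω') := by
    refine (ContinuousOn.aemeasurable ?_ hh.isOpen.measurableSet).ennreal_ofReal
    exact (ContinuousLinearMap.continuous_det.comp_continuousOn
      (hh.smooth_inv.continuousOn_fderiv_of_isOpen hh.isOpen (by simp))).abs
  have hmap : ((volume.restrict Ω').withDensity fun y => ENNReal.ofReal |(fderiv ℝ k y).det|).map k
      = volume.restrict Ω := by
    rw [map_withDensity_abs_det_fderiv_eq_addHaar volume hh.isOpen.measurableSet.nullMeasurableSet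
      (fun y hy => (hsym.hasFDerivAt hh.isOpen hy).hasFDerivWithinAt) hh.invOn.symm.1.injOn,
      hh.image_inv]
  have hk1 : AEMeasurable k
      ((volume.restrict Ω').withDensity fun y => ENNReal.ofReal |(fderiv ℝ k y).det|) :=
    hk.mono_ac (withDensity_absolutelyContinuous _ _)
  have hM2 : AEMeasurable (fun x => ENNReal.ofReal (M x ^ 2)) (volume.restrict Ω) :=
    (hMm.pow_const 2).ennreal_ofReal
  refine ⟨hh.smooth.continuousOn.aemeasurable hΩ.measurableSet, hk.mono_ac hac, ?_, ?_, hMm, ?_, ?_⟩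
  · refine hac.ae_le ?_
    filter_upwards [ae_restrict_mem hh.isOpen.measurableSet] with y hy
    exact hh.invOn.2 hy
  · filter_upwards [ae_restrict_mem hΩ.measurableSet] with x hx
    exact hh.invOn.1 hx
  · filter_upwards [ae_restrict_mem hΩ.measurableSet] with x hx
    exact hMpos x hx
  · have h1 := map_withDensity_comp hk1 (f := fun x => ENNReal.ofReal (M x ^ 2))
      (by rw [hmap]; exact hM2)
    rw [hmap] at h1
    rw [← h1]
    have hMk : AEMeasurable (fun y => ENNReal.ofReal (M (k y) ^ 2)) (volume.restrict Ω') := by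
      refine (((hM.continuousOn.comp hh.smooth_inv.continuousOn hh.mapsTo_inv).aemeasurable
        hh.isOpen.measurableSet).pow_const 2).ennreal_ofReal
    rw [← withDensity_mul₀ hdet hMk, transferMeasure]
    congr 2
    funext y
    rw [Pi.mul_apply, ← ENNReal.ofReal_mul (abs_nonneg _), mul_comm]

end IsSmoothChange

/-! ### The transported operator and its coefficients. -/

namespace IsWeightedChange

variable {n : ℕ} {L : DiscreteOp n} {η' : Measure (EuclideanSpace ℝ (Fin n))}
  {M : EuclideanSpace ℝ (Fin n) → ℝ} {h k : EuclideanSpace ℝ (Fin n) → EuclideanSpace ℝ (Fin n)}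

theorem weight_mul_eigfun (H : IsWeightedChange L.η η' M h k) (j : ℕ) :
    ∀ᵐ x ∂L.η, M x * ((M (k (h x)))⁻¹ * L.eigfun j (k (h x))) = L.eigfun j x := by
  filter_upwards [H.left_inv, H.weight_pos] with x h1 h2
  rw [h1, mul_inv_cancel_left₀ h2.ne']

/-- One factor of the density `M²` cancels the `1/M` of the transported eigenfunction; the other is
the weight in `transfer`. -/
theorem integral_mul_eigfun (H : IsWeightedChange L.η η' M h k)
    (f : EuclideanSpace ℝ (Fin n) → ℝ) (j : ℕ) :
    ∫ y, f y * ((M (k y))⁻¹ * L.eigfun j (k y)) ∂η' = L.coeff (transfer M h f) j := by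
  rw [H.integral_eq, DiscreteOp.coeff]
  refine integral_congr_ae ?_
  filter_upwards [H.weight_mul_eigfun j] with x hx
  rw [← hx, transfer, smul_eq_mul, hx, ← hx]
  ring

theorem integral_mul_eigfun_complex (H : IsWeightedChange L.η η' M h k)
    (u : ℝ × EuclideanSpace ℝ (Fin n) → ℂ) (j : ℕ) (t : ℝ) :
    ∫ y, u (t, y) * (((M (k y))⁻¹ * L.eigfun j (k y) : ℝ) : ℂ) ∂η' =
      L.tcoeff (transferT M h u) j t := by
  rw [H.integral_eq, DiscreteOp.tcoeff]
  refine integral_congr_ae ?_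
  filter_upwards [H.weight_mul_eigfun j] with x hx
  rw [← hx, transferT, Complex.real_smul, hx, ← hx]
  push_cast
  ring

theorem memLp_transfer_iff (H : IsWeightedChange L.η η' M h k)
    {f : EuclideanSpace ℝ (Fin n) → ℝ} : MemLp (transfer M h f) 2 L.η ↔ MemLp f 2 η' :=
  H.memLp_iff

theorem transferT_eq (u : ℝ × EuclideanSpace ℝ (Fin n) → ℂ) :
    transferT M h u = fun p => M p.2 • u (Prod.map id h p) := by
  funext p
  rw [transferT, Complex.real_smul]
  rfl

theorem memLp_transferT_iff (H : IsWeightedChange L.η η' M h k) [SFinite L.η] [SFinite η']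
    {u : ℝ × EuclideanSpace ℝ (Fin n) → ℂ} :
    MemLp (transferT M h u) 2 L.stMeasure ↔ MemLp u 2 ((volume : Measure ℝ).prod η') := by
  rw [transferT_eq]
  exact (H.prod volume).memLp_iff

theorem eLpNorm_transferT (H : IsWeightedChange L.η η' M h k) [SFinite L.η] [SFinite η']
    {u : ℝ × EuclideanSpace ℝ (Fin n) → ℂ} (hu : MemLp u 2 ((volume : Measure ℝ).prod η')) :
    eLpNorm (transferT M h u) 2 L.stMeasure = eLpNorm u 2 ((volume : Measure ℝ).prod η') := by
  rw [transferT_eq]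
  exact (H.prod volume).eLpNorm_eq hu.1

end IsWeightedChange

namespace DiscreteOp

variable {n : ℕ}

theorem coeff_eigfun (L : DiscreteOp n) (j l : ℕ) :
    L.coeff (L.eigfun j) l = if j = l then 1 else 0 := L.orthonormal j l

/-- The operator with the eigenvalues of `L` and the eigenfunctions `φ_j ∘ k / M ∘ k`. -/
noncomputable def transferOp (L : DiscreteOp n) {Ω' : Set (EuclideanSpace ℝ (Fin n))} (hΩ' : IsOpen Ω')
    {η' : Measure (EuclideanSpace ℝ (Fin n))} {M : EuclideanSpace ℝ (Fin n) → ℝ}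
    {h k : EuclideanSpace ℝ (Fin n) → EuclideanSpace ℝ (Fin n)}
    (H : IsWeightedChange L.η η' M h k) : DiscreteOp n where
  Ω := Ω'
  isOpen := hΩ'
  η := η'
  eigval := L.eigval
  eigfun j y := (M (k y))⁻¹ * L.eigfun j (k y)
  eigval_nonneg := L.eigval_nonneg
  memLp j := H.memLp_transfer_iff.1 ((memLp_congr_ae (H.weight_mul_eigfun j)).2 (L.memLp j))
  orthonormal j l := by
    rw [H.integral_mul_eigfun, ← L.orthonormal j l, coeff]
    refine integral_congr_ae ?_
    filter_upwards [H.weight_mul_eigfun j] with x hx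
    rw [transfer, hx]
  complete f hf h0 := by
    have h1 := L.complete (transfer M h f) (H.memLp_transfer_iff.2 hf) fun j => by
      rw [← h0 j, H.integral_mul_eigfun, coeff]
    refine H.ae_iff.1 ?_
    filter_upwards [h1, H.weight_pos] with x hx hp
    exact (mul_eq_zero.1 hx).resolve_left hp.ne'

section

variable {L : DiscreteOp n} {Ω' : Set (EuclideanSpace ℝ (Fin n))} (hΩ' : IsOpen Ω')
    {η' : Measure (EuclideanSpace ℝ (Fin n))} {M : EuclideanSpace ℝ (Fin n) → ℝ}
    {h k : EuclideanSpace ℝ (Fin n) → EuclideanSpace ℝ (Fin n)}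
    (H : IsWeightedChange L.η η' M h k)

theorem transferOp_coeff (f : EuclideanSpace ℝ (Fin n) → ℝ) :
    (L.transferOp hΩ' H).coeff f = L.coeff (transfer M h f) :=
  funext fun j => H.integral_mul_eigfun f j

theorem transferOp_tcoeff (u : ℝ × EuclideanSpace ℝ (Fin n) → ℂ) :
    (L.transferOp hΩ' H).tcoeff u = L.tcoeff (transferT M h u) :=
  funext fun j => funext fun t => H.integral_mul_eigfun_complex u j t

theorem transferOp_memDom_iff (f : EuclideanSpace ℝ (Fin n) → ℝ) :
    (L.transferOp hΩ' H).MemDom f ↔ L.MemDom (transfer M h f) := by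
  rw [MemDom, MemDom, transferOp_coeff, H.memLp_transfer_iff]
  rfl

theorem transferOp_form (f g : EuclideanSpace ℝ (Fin n) → ℝ) :
    (L.transferOp hΩ' H).form f g = L.form (transfer M h f) (transfer M h g) := by
  rw [form, form, transferOp_coeff, transferOp_coeff]
  rfl

theorem transferOp_memDomH_iff [SFinite L.η] [SFinite η'] (s : ℝ)
    (u : ℝ × EuclideanSpace ℝ (Fin n) → ℂ) :
    (L.transferOp hΩ' H).MemDomH s u ↔ L.MemDomH s (transferT M h u) := by
  rw [MemDomH, MemDomH, transferOp_tcoeff, H.memLp_transferT_iff]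
  rfl

theorem transferOp_pairH (s : ℝ) (u v : ℝ × EuclideanSpace ℝ (Fin n) → ℂ) :
    (L.transferOp hΩ' H).pairH s u v = L.pairH s (transferT M h u) (transferT M h v) := by
  rw [pairH, pairH, transferOp_tcoeff, transferOp_tcoeff]
  rfl

theorem transferOp_zeroMean_iff (u : ℝ × EuclideanSpace ℝ (Fin n) → ℂ) :
    (L.transferOp hΩ' H).ZeroMean u ↔ L.ZeroMean (transferT M h u) := by
  rw [ZeroMean, ZeroMean, transferOp_tcoeff]
  rfl

end

end DiscreteOp

/-! ### Diagonal operators in two Hilbert bases. -/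

section HilbertBases

variable {𝓗 : Type*} [NormedAddCommGroup 𝓗] [InnerProductSpace ℂ 𝓗]
  {b b' : HilbertBasis ℕ ℂ 𝓗} {lam lam' : ℕ → ℝ}

theorem HilbertBasis.hasSum_norm_inner_sq (b : HilbertBasis ℕ ℂ 𝓗) (w : 𝓗) :
    HasSum (fun j => ‖inner ℂ (b j) w‖ ^ 2) (‖w‖ ^ 2) := by
  have h1 := (b.hasSum_inner_mul_inner w w).mapL Complex.reCLM
  rw [Complex.reCLM_apply, ← RCLike.re_eq_complex_re, inner_self_eq_norm_sq] at h1
  convert h1 using 2 with j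
  rw [← inner_conj_symm w, ← Complex.normSq_eq_conj_mul_self, Complex.reCLM_apply,
    Complex.ofReal_re, Complex.normSq_eq_norm_sq]

/-- If the vectors of two Hilbert bases belonging to different eigenvalues are orthogonal, the
functional calculi of the two diagonal operators agree. -/
theorem HilbertBasis.exists_functional_calculus
    (hT : ∀ j l, inner ℂ (b j) (b' l) ≠ (0 : ℂ) → lam j = lam' l) (G : ℝ → ℂ) (w : 𝓗)
    (hs : Summable fun l => ‖G (lam' l) * inner ℂ (b' l) w‖ ^ 2) :
    ∃ w' : 𝓗, (∀ l, inner ℂ (b' l) w' = G (lam' l) * inner ℂ (b' l) w) ∧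
      ∀ j, inner ℂ (b j) w' = G (lam j) * inner ℂ (b j) w := by
  have hmem : Memℓp (fun l => G (lam' l) * inner ℂ (b' l) w) 2 := by
    refine memℓp_gen ?_
    simpa using hs
  refine ⟨b'.repr.symm ⟨_, hmem⟩, ?_⟩
  have h1 : ∀ l, inner ℂ (b' l) (b'.repr.symm ⟨_, hmem⟩) = G (lam' l) * inner ℂ (b' l) w := by
    intro l
    rw [← b'.repr_apply_apply, LinearIsometryEquiv.apply_symm_apply]
  refine ⟨h1, fun j => ?_⟩
  -- In the expansion along `b'` only indices with `lam' l = lam j` contribute, so `G` leaves the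
  -- sum as the constant `G (lam j)`.
  rw [← b'.tsum_inner_mul_inner (b j) (b'.repr.symm ⟨_, hmem⟩),
    ← b'.tsum_inner_mul_inner (b j) w, ← tsum_mul_left]
  refine tsum_congr fun l => ?_
  rw [h1]
  by_cases h0 : inner ℂ (b j) (b' l) = (0 : ℂ)
  · simp [h0]
  · rw [hT j l h0]
    ring

/-- If the right side is finite, the vector `G(T) w` exists and both sides are its squared norm by
Parseval; otherwise there is nothing to prove. -/
theorem HilbertBasis.tsum_ofReal_le
    (hT : ∀ j l, inner ℂ (b j) (b' l) ≠ (0 : ℂ) → lam j = lam' l) (G : ℝ → ℂ) (w : 𝓗) :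
    ∑' j, ENNReal.ofReal (‖G (lam j) * inner ℂ (b j) w‖ ^ 2) ≤
      ∑' l, ENNReal.ofReal (‖G (lam' l) * inner ℂ (b' l) w‖ ^ 2) := by
  by_cases hs : Summable fun l => ‖G (lam' l) * inner ℂ (b' l) w‖ ^ 2
  · obtain ⟨w', h1, h2⟩ := HilbertBasis.exists_functional_calculus hT G w hs
    have e1 := b.hasSum_norm_inner_sq w'
    have e2 := b'.hasSum_norm_inner_sq w'
    simp_rw [← h1, ← h2]
    rw [← ENNReal.ofReal_tsum_of_nonneg (fun _ => by positivity) e1.summable,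
      ← ENNReal.ofReal_tsum_of_nonneg (fun _ => by positivity) e2.summable, e1.tsum_eq, e2.tsum_eq]
  · refine le_of_le_of_eq le_top (Eq.symm ?_)
    by_contra hne
    refine hs ?_
    have := ENNReal.summable_toReal hne
    simpa [ENNReal.toReal_ofReal, sq_nonneg] using this

theorem HilbertBasis.eigval_eq_symm
    (hT : ∀ j l, inner ℂ (b j) (b' l) ≠ (0 : ℂ) → lam j = lam' l) :
    ∀ j l, inner ℂ (b' j) (b l) ≠ (0 : ℂ) → lam' j = lam l := by
  intro j l h0
  refine (hT l j fun h1 => h0 ?_).symm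
  rw [← inner_conj_symm, h1, map_zero]

theorem HilbertBasis.tsum_ofReal_eq
    (hT : ∀ j l, inner ℂ (b j) (b' l) ≠ (0 : ℂ) → lam j = lam' l) (G : ℝ → ℂ) (w : 𝓗) :
    ∑' j, ENNReal.ofReal (‖G (lam j) * inner ℂ (b j) w‖ ^ 2) =
      ∑' l, ENNReal.ofReal (‖G (lam' l) * inner ℂ (b' l) w‖ ^ 2) :=
  le_antisymm (HilbertBasis.tsum_ofReal_le hT G w)
    (HilbertBasis.tsum_ofReal_le (HilbertBasis.eigval_eq_symm hT) G w)

/-- Both sums are the inner product of `conj(G)(T) z` with `G(T) w`. Splitting the multiplier as a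
square means that each vector only has to lie in the domain of `G(T)`, which is what finite energy
provides. -/
theorem HilbertBasis.tsum_sq_mul_eq
    (hT : ∀ j l, inner ℂ (b j) (b' l) ≠ (0 : ℂ) → lam j = lam' l) (G : ℝ → ℂ) (w z : 𝓗)
    (hw : ∑' l, ENNReal.ofReal (‖G (lam' l) * inner ℂ (b' l) w‖ ^ 2) ≠ ⊤)
    (hz : ∑' l, ENNReal.ofReal (‖G (lam' l) * inner ℂ (b' l) z‖ ^ 2) ≠ ⊤) :
    ∑' j, G (lam j) ^ 2 * inner ℂ (b j) w * (starRingEnd ℂ) (inner ℂ (b j) z) =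
      ∑' l, G (lam' l) ^ 2 * inner ℂ (b' l) w * (starRingEnd ℂ) (inner ℂ (b' l) z) := by
  have hsw : Summable fun l => ‖G (lam' l) * inner ℂ (b' l) w‖ ^ 2 := by
    simpa [ENNReal.toReal_ofReal, sq_nonneg] using ENNReal.summable_toReal hw
  have hsz : Summable fun l => ‖(starRingEnd ℂ) (G (lam' l)) * inner ℂ (b' l) z‖ ^ 2 := by
    have := ENNReal.summable_toReal hz
    simp only [norm_mul, RCLike.norm_conj] at this ⊢
    simpa [ENNReal.toReal_ofReal, sq_nonneg] using this
  obtain ⟨w', hw1, hw2⟩ := HilbertBasis.exists_functional_calculus hT G w hsw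
  obtain ⟨z', hz1, hz2⟩ := HilbertBasis.exists_functional_calculus hT
    (fun x => (starRingEnd ℂ) (G x)) z hsz
  have e1 := b.tsum_inner_mul_inner z' w'
  have e2 := b'.tsum_inner_mul_inner z' w'
  rw [← e2] at e1
  refine (tsum_congr fun j => ?_).trans (e1.trans (tsum_congr fun j => ?_))
  · rw [← inner_conj_symm z', hw2, hz2, map_mul, Complex.conj_conj]
    ring
  · rw [← inner_conj_symm z', hw1, hz1, map_mul, Complex.conj_conj]
    ring

end HilbertBases

/-! ### Fourier transform of Hilbert space valued functions. -/

section VectorFourier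

/-- Both sides are continuous in `f`, so Schwartz functions suffice; for these `T` passes under the
Fourier integral. -/
theorem fourier_compLpL {F F' : Type*} [NormedAddCommGroup F] [InnerProductSpace ℂ F]
    [CompleteSpace F] [NormedAddCommGroup F'] [InnerProductSpace ℂ F'] [CompleteSpace F']
    (T : F →L[ℂ] F') (f : Lp F 2 (volume : Measure ℝ)) :
    𝓕 (T.compLpL 2 volume f) = T.compLpL 2 volume (𝓕 f) := by
  refine DenseRange.induction_on (p := fun f => 𝓕 (T.compLpL 2 volume f) =
    T.compLpL 2 volume (𝓕 f)) (SchwartzMap.denseRange_toLpCLM (p := 2)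
      ENNReal.ofNat_ne_top) f ?_ ?_
  · refine isClosed_eq ?_ ?_
    · exact (Lp.fourierTransformₗᵢ ℝ F').continuous.comp (T.compLpL 2 volume).continuous
    · exact (T.compLpL 2 volume).continuous.comp (Lp.fourierTransformₗᵢ ℝ F).continuous
  · intro g
    have key : ∀ g : SchwartzMap ℝ F,
        T.compLpL 2 volume (g.toLp 2) = (g.postcompCLM T).toLp 2 := by
      intro g
      refine Lp.ext ?_
      filter_upwards [T.coeFn_compLpL (g.toLp 2 (volume : Measure ℝ)),
        g.coeFn_toLp 2 (volume : Measure ℝ),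
        (g.postcompCLM T).coeFn_toLp 2 (volume : Measure ℝ)] with x h1 h2 h3
      rw [h1, h2, h3, SchwartzMap.postcompCLM_apply]
    rw [SchwartzMap.toLpCLM_apply, key, SchwartzMap.toLp_fourier_eq, SchwartzMap.toLp_fourier_eq,
      key]
    congr 1
    ext ξ
    rw [SchwartzMap.postcompCLM_apply, SchwartzMap.fourier_coe, SchwartzMap.fourier_coe,
      Real.fourier_eq, Real.fourier_eq, ← T.integral_comp_comm]
    · simp [Circle.smul_def]
    · exact (Real.fourierIntegral_convergent_iff ξ).2 g.integrable

theorem ae_comp_div {P : ℝ → Prop} {a : ℝ} (ha : a ≠ 0) (hP : ∀ᵐ x : ℝ, P x) :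
    ∀ᵐ x : ℝ, P (x / a) := by
  have h1 : (volume : Measure ℝ).map (a⁻¹ * ·) ≪ volume := by
    rw [Real.map_volume_mul_left (inv_ne_zero ha)]
    exact Measure.smul_absolutelyContinuous
  have h2 := ae_of_ae_map (measurable_const_mul a⁻¹).aemeasurable (h1.ae_le hP)
  filter_upwards [h2] with x hx
  rwa [div_eq_inv_mul]

theorem l2Fourier_congr {f g : ℝ → ℂ} (hfg : f =ᵐ[volume] g) : l2Fourier f = l2Fourier g := by
  funext ρ
  unfold l2Fourier
  by_cases hf : MemLp f 2 (volume : Measure ℝ)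
  · have hg : MemLp g 2 (volume : Measure ℝ) := (memLp_congr_ae hfg).1 hf
    have e : hf.toLp f = hg.toLp g := MemLp.toLp_eq_toLp_iff hf hg |>.2 hfg
    rw [dif_pos hf, dif_pos hg, e]
  · have hg : ¬ MemLp g 2 (volume : Measure ℝ) := fun hg => hf ((memLp_congr_ae hfg).2 hg)
    rw [dif_neg hf, dif_neg hg]

/-- `V` is the rescaled vector-valued transform of `U`, and `fourier_compLpL` applied to the
functional `inner ℂ w` identifies its components. The exceptional null set depends on `w`, so later
uses are restricted to countably many `w`. -/
theorem exists_l2Fourier_inner {F : Type*} [NormedAddCommGroup F] [InnerProductSpace ℂ F]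
    [CompleteSpace F] {U : ℝ → F} (hU : MemLp U 2 volume) :
    ∃ V : ℝ → F, ∀ w : F, l2Fourier (fun t => inner ℂ w (U t)) =ᵐ[volume] fun ρ =>
      inner ℂ w (V ρ) := by
  refine ⟨fun ρ => (((Real.sqrt (2 * Real.pi))⁻¹ : ℝ) : ℂ) •
    (𝓕 (hU.toLp U) : Lp F 2 (volume : Measure ℝ)) (ρ / (2 * Real.pi)), fun w => ?_⟩
  have hw : MemLp (fun t => inner ℂ w (U t)) 2 (volume : Measure ℝ) :=
    (innerSL ℂ w).comp_memLp' hU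
  have e : hw.toLp _ = (innerSL ℂ w).compLpL 2 volume (hU.toLp U) := by
    refine Lp.ext ?_
    filter_upwards [hw.coeFn_toLp, hU.coeFn_toLp,
      (innerSL ℂ w).coeFn_compLpL (hU.toLp U)] with x h1 h2 h3
    rw [h1, h3, h2, innerSL_apply_apply]
  have h1 := (innerSL ℂ w).coeFn_compLpL (𝓕 (hU.toLp U) : Lp F 2 (volume : Measure ℝ))
  filter_upwards [ae_comp_div (a := 2 * Real.pi) (by positivity) h1] with ρ hρ
  rw [l2Fourier, dif_pos hw, e, fourier_compLpL, hρ, innerSL_apply_apply, inner_smul_right]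

end VectorFourier

/-! ### Space-time functions as `L²`-valued functions of time. -/

section SliceFunction

variable {X : Type*} [MeasurableSpace X] {μ : Measure X}

theorem memLp_two_slice [SFinite μ] {u : ℝ × X → ℂ}
    (hu : MemLp u 2 ((volume : Measure ℝ).prod μ)) :
    ∀ᵐ t : ℝ, MemLp (fun x => u (t, x)) 2 μ := by
  have h1 : ∫⁻ p, ‖u p‖ₑ ^ (2 : ℝ) ∂((volume : Measure ℝ).prod μ) < ⊤ := by
    simpa using lintegral_rpow_enorm_lt_top_of_eLpNorm_lt_top (by norm_num) (by norm_num) hu.2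
  have hm : AEMeasurable (fun p => ‖u p‖ₑ ^ (2 : ℝ)) ((volume : Measure ℝ).prod μ) :=
    hu.1.enorm.pow_const _
  rw [lintegral_prod _ hm] at h1
  filter_upwards [ae_lt_top' hm.lintegral_prod_right' h1.ne, hu.1.prodMk_left] with t h2 h3
  refine ⟨h3, ?_⟩
  rw [eLpNorm_lt_top_iff_lintegral_rpow_enorm_lt_top (by norm_num) (by norm_num)]
  simpa using h2

theorem exists_slice_memLp [SFinite μ] (b : HilbertBasis ℕ ℂ (Lp ℂ 2 μ)) {u : ℝ × X → ℂ}
    (hu : MemLp u 2 ((volume : Measure ℝ).prod μ)) :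
    ∃ U : ℝ → Lp ℂ 2 μ, MemLp U 2 volume ∧
      ∀ w : Lp ℂ 2 μ, ∀ᵐ t : ℝ, inner ℂ w (U t) = ∫ x, u (t, x) * (starRingEnd ℂ) (w x) ∂μ := by
  classical
  let U : ℝ → Lp ℂ 2 μ := fun t =>
    -- The value zero is taken only on the null set of times whose slice is not square integrable.
    if ht : MemLp (fun x => u (t, x)) 2 μ then ht.toLp _ else 0
  have hslice := memLp_two_slice hu
  have hinner : ∀ w : Lp ℂ 2 μ, ∀ᵐ t : ℝ,
      inner ℂ w (U t) = ∫ x, u (t, x) * (starRingEnd ℂ) (w x) ∂μ := by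
    intro w
    filter_upwards [hslice] with t ht
    have e : U t = ht.toLp _ := dif_pos ht
    rw [e, L2.inner_def]
    refine integral_congr_ae ?_
    filter_upwards [ht.coeFn_toLp] with x hx
    rw [hx, RCLike.inner_apply]
  have hmeas : ∀ w : Lp ℂ 2 μ, AEStronglyMeasurable (fun t => inner ℂ w (U t))
      (volume : Measure ℝ) := by
    intro w
    refine AEStronglyMeasurable.congr ?_ ((hinner w).mono fun t ht => ht.symm)
    have hw : AEStronglyMeasurable (fun p : ℝ × X => (starRingEnd ℂ) (w p.2))
        ((volume : Measure ℝ).prod μ) :=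
      Complex.continuous_conj.comp_aestronglyMeasurable
        ((Lp.aestronglyMeasurable w).comp_quasiMeasurePreserving
          Measure.quasiMeasurePreserving_snd)
    exact (hu.1.mul hw).integral_prod_right'
  have hUm : AEStronglyMeasurable U volume := by
    -- Strong measurability follows from measurability of the coefficients, since `U` is the
    -- pointwise limit of the partial sums of its expansion in `b`.
    refine aestronglyMeasurable_of_tendsto_ae Filter.atTop
      (f := fun (N : ℕ) t => ∑ j ∈ Finset.range N, (inner ℂ (b j) (U t) : ℂ) • b j) ?_ ?_
    · intro N
      exact Finset.aestronglyMeasurable_fun_sum _ fun j _ =>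
        (hmeas (b j)).smul aestronglyMeasurable_const
    · refine Filter.Eventually.of_forall fun t => ?_
      have := (b.hasSum_repr (U t)).tendsto_sum_nat
      simpa only [b.repr_apply_apply] using this
  refine ⟨U, ⟨hUm, ?_⟩, hinner⟩
  rw [eLpNorm_lt_top_iff_lintegral_rpow_enorm_lt_top (by norm_num) (by norm_num)]
  have h1 : ∫⁻ p, ‖u p‖ₑ ^ (2 : ℝ) ∂((volume : Measure ℝ).prod μ) < ⊤ := by
    simpa using lintegral_rpow_enorm_lt_top_of_eLpNorm_lt_top (by norm_num) (by norm_num) hu.2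
  rw [lintegral_prod _ (hu.1.enorm.pow_const _)] at h1
  refine lt_of_le_of_lt (lintegral_mono_ae ?_) h1
  filter_upwards [hslice] with t ht
  have e : U t = ht.toLp _ := dif_pos ht
  rw [e, Lp.enorm_toLp, eLpNorm_eq_lintegral_rpow_enorm_toReal (by norm_num) (by norm_num),
    ← ENNReal.rpow_mul]
  norm_num

end SliceFunction

/-! ### Independence of `H^s` from the choice of eigenbasis. -/

namespace DiscreteOp

variable {n : ℕ} {μ : Measure (EuclideanSpace ℝ (Fin n))}

theorem memLp_complex (L : DiscreteOp n) (hμ : L.η = μ) (j : ℕ) :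
    MemLp (fun x => (L.eigfun j x : ℂ)) 2 μ :=
  hμ ▸ (L.memLp j).ofReal

/-- The eigenfunction `φ_j` as an element of the complex `L²` space. -/
noncomputable def eigenvec (L : DiscreteOp n) (hμ : L.η = μ) (j : ℕ) : Lp ℂ 2 μ :=
  (L.memLp_complex hμ j).toLp _

theorem inner_eigenvec (L : DiscreteOp n) (hμ : L.η = μ) (j : ℕ) (w : Lp ℂ 2 μ) :
    inner ℂ (L.eigenvec hμ j) w = ∫ x, w x * (L.eigfun j x : ℂ) ∂μ := by
  rw [L2.inner_def]
  refine integral_congr_ae ?_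
  filter_upwards [(L.memLp_complex hμ j).coeFn_toLp] with x hx
  rw [eigenvec, hx, RCLike.inner_apply, Complex.conj_ofReal]

theorem inner_eigenvec_eigenvec (A B : DiscreteOp n) (hA : A.η = μ) (hB : B.η = μ) (j l : ℕ) :
    inner ℂ (A.eigenvec hA j) (B.eigenvec hB l) = ((A.coeff (B.eigfun l) j : ℝ) : ℂ) := by
  rw [inner_eigenvec, coeff, ← integral_complex_ofReal, hA]
  refine integral_congr_ae ?_
  filter_upwards [(B.memLp_complex hB l).coeFn_toLp] with x hx
  rw [eigenvec, hx]
  push_cast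
  rfl

theorem orthonormal_eigenvec (L : DiscreteOp n) (hμ : L.η = μ) :
    Orthonormal ℂ (L.eigenvec hμ) := by
  rw [orthonormal_iff_ite]
  intro i j
  rw [inner_eigenvec_eigenvec, coeff_eigfun]
  by_cases h : i = j
  · simp [h]
  · simp [h, Ne.symm h]

/-- Completeness is assumed for real functions only; since the eigenfunctions are real, it applies
separately to the real and imaginary parts of `w`. -/
theorem eq_zero_of_inner_eigenvec (L : DiscreteOp n) (hμ : L.η = μ) (w : Lp ℂ 2 μ)
    (hw : ∀ j, inner ℂ (L.eigenvec hμ j) w = (0 : ℂ)) : w = 0 := by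
  have hwm : MemLp w 2 L.η := hμ ▸ Lp.memLp w
  have hint : ∀ j, Integrable (fun x => w x * (L.eigfun j x : ℂ)) L.η := fun j =>
    hwm.integrable_mul (L.memLp j).ofReal
  have h0 : ∀ j, ∫ x, w x * (L.eigfun j x : ℂ) ∂L.η = 0 := fun j => by
    rw [← hw j, inner_eigenvec, hμ]
  have hre := L.complete (fun x => (w x).re) hwm.re fun j => by
    have := congrArg Complex.re (h0 j)
    rw [← Complex.reCLM_apply, ← Complex.reCLM.integral_comp_comm (hint j)] at this
    simpa using this
  have him := L.complete (fun x => (w x).im) hwm.im fun j => by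
    have := congrArg Complex.im (h0 j)
    rw [← Complex.imCLM_apply, ← Complex.imCLM.integral_comp_comm (hint j)] at this
    simpa using this
  rw [Lp.eq_zero_iff_ae_eq_zero]
  rw [hμ] at hre him
  filter_upwards [hre, him] with x h1 h2
  exact Complex.ext h1 h2

/-- The Hilbert basis of eigenfunctions of the complex `L²` space. -/
noncomputable def hilbertBasis (L : DiscreteOp n) (hμ : L.η = μ) :
    HilbertBasis ℕ ℂ (Lp ℂ 2 μ) :=
  HilbertBasis.mkOfOrthogonalEqBot (L.orthonormal_eigenvec hμ) <| by
    refine (Submodule.eq_bot_iff _).2 fun w hw => L.eq_zero_of_inner_eigenvec hμ w fun j => ?_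
    exact (Submodule.mem_orthogonal _ _).1 hw _ (Submodule.subset_span ⟨j, rfl⟩)

theorem hilbertBasis_apply (L : DiscreteOp n) (hμ : L.η = μ) (j : ℕ) :
    L.hilbertBasis hμ j = L.eigenvec hμ j := by
  rw [hilbertBasis, HilbertBasis.coe_mkOfOrthogonalEqBot]

/-- `U` is chosen before `L`, so all resolutions over the same measure are compared through the same
vectors. `L₀` only supplies some Hilbert basis for the measurability of `U`. -/
theorem exists_tcoeff_eq_inner [SFinite μ] (L₀ : DiscreteOp n) (h₀ : L₀.η = μ)
    {u : ℝ × EuclideanSpace ℝ (Fin n) → ℂ} (hu : MemLp u 2 ((volume : Measure ℝ).prod μ)) :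
    ∃ U : ℝ → Lp ℂ 2 μ, MemLp U 2 volume ∧ ∀ (L : DiscreteOp n) (hμ : L.η = μ) (j : ℕ),
      L.tcoeff u j =ᵐ[volume] fun t => inner ℂ (L.hilbertBasis hμ j) (U t) := by
  obtain ⟨U, hU, hUi⟩ := exists_slice_memLp (L₀.hilbertBasis h₀) hu
  refine ⟨U, hU, fun L hμ j => ?_⟩
  filter_upwards [hUi (L.hilbertBasis hμ j)] with t ht
  rw [ht, tcoeff, hμ]
  refine integral_congr_ae ?_
  filter_upwards [(L.memLp_complex hμ j).coeFn_toLp] with x hx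
  rw [hilbertBasis_apply, eigenvec, hx, Complex.conj_ofReal]

theorem exists_l2Fourier_tcoeff_eq_inner [SFinite μ] (L₀ : DiscreteOp n) (h₀ : L₀.η = μ)
    {u : ℝ × EuclideanSpace ℝ (Fin n) → ℂ} (hu : MemLp u 2 ((volume : Measure ℝ).prod μ)) :
    ∃ V : ℝ → Lp ℂ 2 μ, ∀ (L : DiscreteOp n) (hμ : L.η = μ), ∀ᵐ ρ : ℝ, ∀ j,
      l2Fourier (L.tcoeff u j) ρ = inner ℂ (L.hilbertBasis hμ j) (V ρ) := by
  obtain ⟨U, hU, hUi⟩ := exists_tcoeff_eq_inner L₀ h₀ hu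
  obtain ⟨V, hV⟩ := exists_l2Fourier_inner hU
  refine ⟨V, fun L hμ => ae_all_iff.2 fun j => ?_⟩
  rw [l2Fourier_congr (hUi L hμ j)]
  exact hV _

/-- `A` and `B` are spectral resolutions of the same operator: they have the same form. -/
structure SameForm (A B : DiscreteOp n) : Prop where
  measure_eq : B.η = A.η
  memDom_iff : ∀ f, A.MemDom f ↔ B.MemDom f
  form_eq : ∀ f g, A.MemDom f → A.MemDom g → A.form f g = B.form f g

theorem memDom_eigfun (L : DiscreteOp n) (j : ℕ) : L.MemDom (L.eigfun j) := by
  refine ⟨L.memLp j, summable_of_ne_finset_zero (s := {j}) fun l hl => ?_⟩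
  rw [coeff_eigfun, if_neg (by simpa [eq_comm] using hl)]
  simp

theorem form_eigfun_left (L : DiscreteOp n) (j : ℕ) (g : EuclideanSpace ℝ (Fin n) → ℝ) :
    L.form (L.eigfun j) g = L.eigval j * L.coeff g j := by
  rw [form, tsum_eq_single j]
  · simp [coeff_eigfun]
  · intro l hl
    simp [coeff_eigfun, hl.symm]

theorem form_eigfun_right (L : DiscreteOp n) (j : ℕ) (f : EuclideanSpace ℝ (Fin n) → ℝ) :
    L.form f (L.eigfun j) = L.eigval j * L.coeff f j := by
  rw [form, tsum_eq_single j]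
  · simp [coeff_eigfun]
  · intro l hl
    simp [coeff_eigfun, hl.symm]

/-- The form at the pair of eigenfunctions, computed in either resolution, is the respective
eigenvalue times their inner product, which can be cancelled. -/
theorem SameForm.eigval_eq {A B : DiscreteOp n} (hAB : A.SameForm B) (j l : ℕ)
    (h0 : inner ℂ (A.hilbertBasis rfl j) (B.hilbertBasis hAB.measure_eq l) ≠ (0 : ℂ)) :
    A.eigval j = B.eigval l := by
  rw [hilbertBasis_apply, hilbertBasis_apply, inner_eigenvec_eigenvec] at h0
  have h1 := hAB.form_eq (A.eigfun j) (B.eigfun l) (A.memDom_eigfun j)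
    ((hAB.memDom_iff _).2 (B.memDom_eigfun l))
  have h2 : B.coeff (A.eigfun j) l = A.coeff (B.eigfun l) j := by
    rw [coeff, coeff, hAB.measure_eq]
    simp_rw [mul_comm]
  rw [form_eigfun_left, form_eigfun_right, h2] at h1
  exact mul_right_cancel₀ (by simpa using h0) h1

theorem SameForm.stMeasure_eq {A B : DiscreteOp n} (hAB : A.SameForm B) :
    B.stMeasure = A.stMeasure := by
  rw [stMeasure, stMeasure, hAB.measure_eq]

/-- Discarding the single frequency `ρ = 0` keeps the base of the power nonzero even for eigenvalue
zero, so that the laws of complex powers apply. -/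
theorem I_mul_add_ne_zero {ρ : ℝ} (hρ : ρ ≠ 0) (x : ℝ) :
    Complex.I * (ρ : ℂ) + (x : ℂ) ≠ 0 := by
  intro h
  have := congrArg Complex.im h
  simp at this
  exact hρ this

theorem norm_rpow_mul_sq {z : ℂ} (hz : z ≠ 0) (s : ℝ) (a : ℂ) :
    ‖z‖ ^ s * ‖a‖ ^ 2 = ‖z ^ ((s / 2 : ℝ) : ℂ) * a‖ ^ 2 := by
  rw [norm_mul, mul_pow, Complex.norm_cpow_of_ne_zero hz]
  simp only [Complex.ofReal_re, Complex.ofReal_im, mul_zero, Real.exp_zero, div_one]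
  rw [← Real.rpow_mul_natCast (norm_nonneg _)]
  congr 2
  push_cast
  ring

theorem cpow_half_sq {z : ℂ} (hz : z ≠ 0) (s : ℝ) :
    (z ^ ((s / 2 : ℝ) : ℂ)) ^ 2 = z ^ (s : ℂ) := by
  rw [sq, ← Complex.cpow_add _ _ hz]
  congr 1
  push_cast
  ring

theorem tsum_energy_eq (L : DiscreteOp n) (hμ : L.η = μ) (s : ℝ) {ρ : ℝ} (hρ : ρ ≠ 0)
    {u : ℝ × EuclideanSpace ℝ (Fin n) → ℂ} {w : Lp ℂ 2 μ}
    (hw : ∀ j, l2Fourier (L.tcoeff u j) ρ = inner ℂ (L.hilbertBasis hμ j) w) :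
    ∑' j, ENNReal.ofReal
      (‖Complex.I * (ρ : ℂ) + (L.eigval j : ℂ)‖ ^ s * ‖l2Fourier (L.tcoeff u j) ρ‖ ^ 2) =
    ∑' j, ENNReal.ofReal (‖(Complex.I * (ρ : ℂ) + (L.eigval j : ℂ)) ^ ((s / 2 : ℝ) : ℂ) *
      inner ℂ (L.hilbertBasis hμ j) w‖ ^ 2) :=
  tsum_congr fun j => by rw [hw, norm_rpow_mul_sq (I_mul_add_ne_zero hρ _)]

theorem SameForm.tsum_energy {A B : DiscreteOp n} (hAB : A.SameForm B) [SFinite A.η]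
    (s : ℝ) {u : ℝ × EuclideanSpace ℝ (Fin n) → ℂ} (hu : MemLp u 2 A.stMeasure) :
    ∀ᵐ ρ : ℝ, ∑' j, ENNReal.ofReal
      (‖Complex.I * (ρ : ℂ) + (A.eigval j : ℂ)‖ ^ s * ‖l2Fourier (A.tcoeff u j) ρ‖ ^ 2) =
      ∑' j, ENNReal.ofReal
      (‖Complex.I * (ρ : ℂ) + (B.eigval j : ℂ)‖ ^ s * ‖l2Fourier (B.tcoeff u j) ρ‖ ^ 2) := by
  obtain ⟨V, hV⟩ := exists_l2Fourier_tcoeff_eq_inner A rfl hu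
  filter_upwards [hV A rfl, hV B hAB.measure_eq, Measure.ae_ne volume 0] with ρ hA hB hρ
  rw [tsum_energy_eq A rfl s hρ hA, tsum_energy_eq B hAB.measure_eq s hρ hB]
  exact HilbertBasis.tsum_ofReal_eq hAB.eigval_eq
    (fun x => (Complex.I * (ρ : ℂ) + (x : ℂ)) ^ ((s / 2 : ℝ) : ℂ)) (V ρ)

theorem SameForm.memDomH_iff {A B : DiscreteOp n} (hAB : A.SameForm B) [SFinite A.η]
    (s : ℝ) (u : ℝ × EuclideanSpace ℝ (Fin n) → ℂ) : A.MemDomH s u ↔ B.MemDomH s u := by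
  rw [MemDomH, MemDomH, hAB.stMeasure_eq]
  refine and_congr_right fun hu => ?_
  rw [lintegral_congr_ae (hAB.tsum_energy s hu)]

theorem MemDomH.ae_tsum_ne_top {L : DiscreteOp n} (hμ : L.η = μ) {s : ℝ}
    {u : ℝ × EuclideanSpace ℝ (Fin n) → ℂ} (hu : L.MemDomH s u) {V : ℝ → Lp ℂ 2 μ}
    (hV : ∀ᵐ ρ : ℝ, ∀ j, l2Fourier (L.tcoeff u j) ρ = inner ℂ (L.hilbertBasis hμ j) (V ρ)) :
    ∀ᵐ ρ : ℝ, ∑' j, ENNReal.ofReal (‖(Complex.I * (ρ : ℂ) + (L.eigval j : ℂ)) ^ ((s / 2 : ℝ) : ℂ) *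
      inner ℂ (L.hilbertBasis hμ j) (V ρ)‖ ^ 2) ≠ ⊤ := by
  have hm : AEMeasurable (fun ρ : ℝ => ∑' j, ENNReal.ofReal
      (‖Complex.I * (ρ : ℂ) + (L.eigval j : ℂ)‖ ^ s * ‖l2Fourier (L.tcoeff u j) ρ‖ ^ 2)) := by
    refine AEMeasurable.tsum fun j => AEMeasurable.ennreal_ofReal
      (AEMeasurable.mul (by fun_prop) (AEMeasurable.pow_const (AEMeasurable.norm ?_) 2))
    unfold l2Fourier
    split_ifs with h
    · refine AEMeasurable.const_mul ?_ _
      exact ((Lp.stronglyMeasurable _).measurable.comp (measurable_id.div_const _)).aemeasurable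
    · exact aemeasurable_const
  filter_upwards [ae_lt_top' hm hu.2.ne, hV, Measure.ae_ne volume 0] with ρ h1 h2 hρ
  rw [tsum_energy_eq L hμ s hρ h2] at h1
  exact h1.ne

/-- The integrands agree for almost every `ρ`: this is `HilbertBasis.tsum_sq_mul_eq` with `G x = (iρ
+ x)^(s/2)`, finite energy making both sums of squares finite at almost every frequency. -/
theorem SameForm.pairH_eq {A B : DiscreteOp n} (hAB : A.SameForm B) [SFinite A.η]
    (s : ℝ) {u v : ℝ × EuclideanSpace ℝ (Fin n) → ℂ} (hu : B.MemDomH s u) (hv : B.MemDomH s v) :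
    A.pairH s u v = B.pairH s u v := by
  obtain ⟨V, hV⟩ := exists_l2Fourier_tcoeff_eq_inner A rfl (hAB.stMeasure_eq ▸ hu.1)
  obtain ⟨W, hW⟩ := exists_l2Fourier_tcoeff_eq_inner A rfl (hAB.stMeasure_eq ▸ hv.1)
  refine integral_congr_ae ?_
  filter_upwards [hV A rfl, hV B hAB.measure_eq, hW A rfl, hW B hAB.measure_eq,
    Measure.ae_ne volume 0, hu.ae_tsum_ne_top hAB.measure_eq (hV B hAB.measure_eq),
    hv.ae_tsum_ne_top hAB.measure_eq (hW B hAB.measure_eq)] with ρ h1 h2 h3 h4 hρ h5 h6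
  have := HilbertBasis.tsum_sq_mul_eq hAB.eigval_eq
    (fun x => (Complex.I * (ρ : ℂ) + (x : ℂ)) ^ ((s / 2 : ℝ) : ℂ)) (V ρ) (W ρ) h5 h6
  simp only [cpow_half_sq (I_mul_add_ne_zero hρ _)] at this
  simpa only [h1, h2, h3, h4] using this

/-- A null eigenfunction of `A` is orthogonal to every eigenfunction of `B` with nonzero eigenvalue,
so its coefficient is built from null coefficients of `B` alone. -/
theorem SameForm.zeroMean {A B : DiscreteOp n} (hAB : A.SameForm B) [SFinite A.η]
    {u : ℝ × EuclideanSpace ℝ (Fin n) → ℂ} (hu : MemLp u 2 A.stMeasure) (hB : B.ZeroMean u) :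
    A.ZeroMean u := by
  obtain ⟨U, -, hU⟩ := exists_tcoeff_eq_inner A rfl hu
  intro j hj
  have hB' : ∀ᵐ t : ℝ, ∀ l, B.eigval l = 0 → B.tcoeff u l t = 0 := by
    refine ae_all_iff.2 fun l => ?_
    by_cases hl : B.eigval l = 0
    · filter_upwards [hB l hl] with t ht _ using ht
    · exact Filter.Eventually.of_forall fun t h => absurd h hl
  have hU' := ae_all_iff.2 (hU B hAB.measure_eq)
  filter_upwards [hB', hU', hU A rfl j] with t h1 h2 h3
  rw [h3, ← (B.hilbertBasis hAB.measure_eq).tsum_inner_mul_inner]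
  refine (tsum_congr fun l => ?_).trans tsum_zero
  by_cases h0 : inner ℂ (A.hilbertBasis rfl j) (B.hilbertBasis hAB.measure_eq l) = (0 : ℂ)
  · rw [h0, zero_mul]
  · rw [← h2 l, h1 l (by rw [← hAB.eigval_eq j l h0, hj]), mul_zero]

end DiscreteOp

/-! ### Behaviour on `Ω` only, and the sign condition. -/

namespace DiscreteOp

variable {n : ℕ}

theorem tcoeff_congr {L : DiscreteOp n} (hη : L.η = volume.restrict L.Ω)
    {u v : ℝ × EuclideanSpace ℝ (Fin n) → ℂ} (huv : ∀ t, ∀ x ∈ L.Ω, u (t, x) = v (t, x)) :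
    L.tcoeff u = L.tcoeff v := by
  funext j t
  rw [tcoeff, tcoeff, hη]
  refine setIntegral_congr_fun L.isOpen.measurableSet fun x hx => ?_
  simp only [huv t x hx]

theorem ae_stMeasure_mem {L : DiscreteOp n} (hη : L.η = volume.restrict L.Ω) :
    ∀ᵐ p ∂L.stMeasure, p.2 ∈ L.Ω := by
  rw [stMeasure, hη]
  exact Measure.quasiMeasurePreserving_snd.ae (ae_restrict_mem L.isOpen.measurableSet)

theorem memDomH_congr {L : DiscreteOp n} (hη : L.η = volume.restrict L.Ω) {s : ℝ}
    {u v : ℝ × EuclideanSpace ℝ (Fin n) → ℂ} (huv : ∀ t, ∀ x ∈ L.Ω, u (t, x) = v (t, x)) :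
    L.MemDomH s u ↔ L.MemDomH s v := by
  have h1 : u =ᵐ[L.stMeasure] v := by
    filter_upwards [ae_stMeasure_mem hη] with p hp
    exact huv p.1 p.2 hp
  rw [MemDomH, MemDomH, tcoeff_congr hη huv, memLp_congr_ae h1]

/-- A continuous function that is negative at one point is negative on a nonempty open set, which
has positive measure. This turns the almost everywhere sign condition into a pointwise one. -/
theorem NonnegBefore.nonneg {L : DiscreteOp n} {T : ℝ}
    {u : ℝ × EuclideanSpace ℝ (Fin n) → ℝ} (hu : L.NonnegBefore T u) {I : Set ℝ}
    {O : Set (EuclideanSpace ℝ (Fin n))} (hI : IsOpen I) (hO : IsOpen O) (hIT : I ⊆ Iio T)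
    (hOΩ : O ⊆ L.Ω) (hc : ContinuousOn u (I ×ˢ O)) {p : ℝ × EuclideanSpace ℝ (Fin n)}
    (hp : p ∈ I ×ˢ O) : 0 ≤ u p := by
  by_contra! h0
  have hopen : IsOpen (I ×ˢ O ∩ u ⁻¹' Iio 0) := hc.isOpen_inter_preimage (hI.prod hO) isOpen_Iio
  refine (hopen.measure_pos volume ⟨p, hp, h0⟩).ne' (measure_mono_null ?_ (ae_iff.1 hu))
  rintro q ⟨hq, hq0⟩ hq'
  exact (mem_Iio.1 hq0).not_ge (hq' (hIT hq.1) (hOΩ hq.2))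

theorem nonnegBefore_iff {L : DiscreteOp n} {T : ℝ} {u : ℝ × EuclideanSpace ℝ (Fin n) → ℝ} :
    L.NonnegBefore T u ↔
      ∀ᵐ p ∂((volume : Measure ℝ).prod (volume.restrict L.Ω)), p.1 < T → 0 ≤ u p := by
  have h1 : (volume : Measure ℝ).prod (volume.restrict L.Ω) =
      (volume : Measure (ℝ × EuclideanSpace ℝ (Fin n))).restrict (univ ×ˢ L.Ω) := by
    rw [Measure.volume_eq_prod, ← Measure.prod_restrict, Measure.restrict_univ]
  rw [h1, ae_restrict_iff' (MeasurableSet.univ.prod L.isOpen.measurableSet)]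
  refine Filter.eventually_congr (Filter.Eventually.of_forall fun p => ?_)
  simp only [mem_prod, mem_univ, true_and]
  tauto

end DiscreteOp

/-! ### Pulling back test functions. -/

section Pullback

variable {n : ℕ} {Ω Ω' : Set (EuclideanSpace ℝ (Fin n))}
  {h k : EuclideanSpace ℝ (Fin n) → EuclideanSpace ℝ (Fin n)}
  {M : EuclideanSpace ℝ (Fin n) → ℝ}

open Classical in
/-- `(U ∘ W)⁻¹ v (t, y) = v(t, k(y)) / M(k(y))` for `y ∈ Ω'`, extended by zero. -/
noncomputable def transferInvT (Ω' : Set (EuclideanSpace ℝ (Fin n)))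
    (M : EuclideanSpace ℝ (Fin n) → ℝ) (k : EuclideanSpace ℝ (Fin n) → EuclideanSpace ℝ (Fin n))
    (v : ℝ × EuclideanSpace ℝ (Fin n) → ℂ) (p : ℝ × EuclideanSpace ℝ (Fin n)) : ℂ :=
  if p.2 ∈ Ω' then (((M (k p.2))⁻¹ : ℝ) : ℂ) * v (p.1, k p.2) else 0

theorem transferInvT_of_mem {v : ℝ × EuclideanSpace ℝ (Fin n) → ℂ}
    {p : ℝ × EuclideanSpace ℝ (Fin n)} (hp : p.2 ∈ Ω') :
    transferInvT Ω' M k v p = (((M (k p.2))⁻¹ : ℝ) : ℂ) * v (p.1, k p.2) := if_pos hp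

theorem transferT_transferInvT (hh : IsSmoothChange Ω Ω' h k) (hMpos : ∀ x ∈ Ω, 0 < M x)
    (v : ℝ × EuclideanSpace ℝ (Fin n) → ℂ) (t : ℝ) {x : EuclideanSpace ℝ (Fin n)} (hx : x ∈ Ω) :
    transferT M h (transferInvT Ω' M k v) (t, x) = v (t, x) := by
  rw [transferT, transferInvT_of_mem (hh.mapsTo hx)]
  simp only [hh.invOn.1 hx]
  rw [← mul_assoc, ← Complex.ofReal_mul, mul_inv_cancel₀ (hMpos x hx).ne', Complex.ofReal_one,
    one_mul]

theorem contDiffOn_inv_weight (hh : IsSmoothChange Ω Ω' h k) (hM : ContDiffOn ℝ ∞ M Ω)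
    (hMpos : ∀ x ∈ Ω, 0 < M x) : ContDiffOn ℝ ∞ (fun y => (M (k y))⁻¹) Ω' :=
  (hM.comp hh.smooth_inv hh.mapsTo_inv).inv fun _ hy => (hMpos _ (hh.mapsTo_inv hy)).ne'

theorem isCompact_image_prodMap (hh : IsSmoothChange Ω Ω' h k)
    {S : Set (ℝ × EuclideanSpace ℝ (Fin n))} (hS : IsCompact S) (hSΩ : S ⊆ univ ×ˢ Ω) :
    IsCompact (Prod.map id h '' S) := by
  refine hS.image_of_continuousOn (ContinuousOn.prodMk continuousOn_fst ?_)
  exact hh.smooth.continuousOn.comp continuousOn_snd fun p hp => (hSΩ hp).2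

/-- The image of the compact support of `v` under `id × h` is compact, hence closed in the whole
space, and it contains every point where the pullback is nonzero. -/
theorem tsupport_transferInvT_subset (hh : IsSmoothChange Ω Ω' h k)
    {v : ℝ × EuclideanSpace ℝ (Fin n) → ℂ} (hv : HasCompactSupport v)
    (hvΩ : tsupport v ⊆ univ ×ˢ Ω) :
    tsupport (transferInvT Ω' M k v) ⊆ Prod.map id h '' tsupport v := by
  refine closure_minimal ?_ (isCompact_image_prodMap hh hv hvΩ).isClosed
  intro p hp
  by_cases hpΩ : p.2 ∈ Ω'
  · rw [Function.mem_support, transferInvT_of_mem hpΩ] at hp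
    refine ⟨(p.1, k p.2), subset_tsupport _ (right_ne_zero_of_mul hp), ?_⟩
    simp [Prod.map, hh.invOn.2 hpΩ]
  · exact absurd (if_neg hpΩ) hp

theorem hasCompactSupport_transferInvT (hh : IsSmoothChange Ω Ω' h k)
    {v : ℝ × EuclideanSpace ℝ (Fin n) → ℂ} (hv : HasCompactSupport v)
    (hvΩ : tsupport v ⊆ univ ×ˢ Ω) : HasCompactSupport (transferInvT Ω' M k v) :=
  (isCompact_image_prodMap hh hv hvΩ).of_isClosed_subset (isClosed_tsupport _)
    (tsupport_transferInvT_subset hh hv hvΩ)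

/-- Extension by zero creates no singularity at the boundary of `Ω'`: the closed support lies over
`Ω'`, so the function vanishes near every point outside. -/
theorem contDiff_transferInvT (hh : IsSmoothChange Ω Ω' h k) (hM : ContDiffOn ℝ ∞ M Ω)
    (hMpos : ∀ x ∈ Ω, 0 < M x) {v : ℝ × EuclideanSpace ℝ (Fin n) → ℂ} (hvs : ContDiff ℝ ∞ v)
    (hv : HasCompactSupport v) (hvΩ : tsupport v ⊆ univ ×ˢ Ω) :
    ContDiff ℝ ∞ (transferInvT Ω' M k v) := by
  rw [contDiff_iff_contDiffAt]
  intro p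
  by_cases hp : p.2 ∈ Ω'
  · have hnhds : Ω' ∈ nhds p.2 := hh.isOpen.mem_nhds hp
    have h1 : ContDiffAt ℝ ∞ (fun p : ℝ × EuclideanSpace ℝ (Fin n) => (M (k p.2))⁻¹) p :=
      ((contDiffOn_inv_weight hh hM hMpos).contDiffAt hnhds).comp p contDiffAt_snd
    have h2 : ContDiffAt ℝ ∞ (fun p : ℝ × EuclideanSpace ℝ (Fin n) => (p.1, k p.2)) p :=
      contDiffAt_fst.prodMk ((hh.smooth_inv.contDiffAt hnhds).comp p contDiffAt_snd)
    have h3 : ContDiffAt ℝ ∞ (fun p : ℝ × EuclideanSpace ℝ (Fin n) =>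
        (((M (k p.2))⁻¹ : ℝ) : ℂ) * v (p.1, k p.2)) p :=
      (Complex.ofRealCLM.contDiff.contDiffAt.comp p h1).mul (hvs.contDiffAt.comp p h2)
    refine h3.congr_of_eventuallyEq ?_
    filter_upwards [continuousAt_snd.preimage_mem_nhds hnhds] with q hq
    exact transferInvT_of_mem hq
  · have h1 : p ∉ tsupport (transferInvT Ω' M k v) := by
      intro hpt
      obtain ⟨q, hq, rfl⟩ := tsupport_transferInvT_subset hh hv hvΩ hpt
      exact hp (hh.mapsTo (hvΩ hq).2)
    exact contDiffAt_const.congr_of_eventuallyEq (notMem_tsupport_iff_eventuallyEq.1 h1)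

end Pullback

/-! ### Transfer of domains, pairings and solutions. -/

namespace IsConjugate

variable {n : ℕ} {L L' : DiscreteOp n} {Ω' : Set (EuclideanSpace ℝ (Fin n))}
  {h k : EuclideanSpace ℝ (Fin n) → EuclideanSpace ℝ (Fin n)}
  {M : EuclideanSpace ℝ (Fin n) → ℝ}

/-- This reduces every resolution of the conjugated operator to the explicit one `transferOp`. -/
theorem sameForm (hc : IsConjugate L L' Ω' M h k) (hΩ' : IsOpen Ω')
    (H : IsWeightedChange L.η (transferMeasure Ω' M k) M h k) :
    (L.transferOp hΩ' H).SameForm L' where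
  measure_eq := hc.measure_eq
  memDom_iff f := by rw [DiscreteOp.transferOp_memDom_iff, hc.memDom_iff]
  form_eq f g hf hg := by
    rw [DiscreteOp.transferOp_memDom_iff, ← hc.memDom_iff] at hf hg
    rw [DiscreteOp.transferOp_form, hc.form_eq f g hf hg]

instance sFinite_transferMeasure : SFinite (transferMeasure Ω' M k) := by
  unfold transferMeasure
  infer_instance

variable (hc : IsConjugate L L' Ω' M h k) (hη : L.η = volume.restrict L.Ω)
  (hh : IsSmoothChange L.Ω Ω' h k) (hM : ContDiffOn ℝ ∞ M L.Ω) (hMpos : ∀ x ∈ L.Ω, 0 < M x)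

include hη hh hM hMpos in
theorem _root_.DiscreteOp.isWeightedChange :
    IsWeightedChange L.η (transferMeasure Ω' M k) M h k :=
  hη ▸ hh.isWeightedChange L.isOpen hM hMpos

theorem sFinite_of_eq (hη : L.η = volume.restrict L.Ω) : SFinite L.η := by
  rw [hη]
  infer_instance

theorem stMeasure_eq (hc : IsConjugate L L' Ω' M h k) :
    L'.stMeasure = (volume : Measure ℝ).prod (transferMeasure Ω' M k) := by
  rw [DiscreteOp.stMeasure, hc.measure_eq]

include hc hη hh hM hMpos

theorem memLp_transferT_iff (u : ℝ × EuclideanSpace ℝ (Fin n) → ℂ) :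
    MemLp u 2 L'.stMeasure ↔ MemLp (transferT M h u) 2 L.stMeasure := by
  have := sFinite_of_eq hη
  rw [hc.stMeasure_eq, (DiscreteOp.isWeightedChange hη hh hM hMpos).memLp_transferT_iff]

theorem eLpNorm_transferT {u : ℝ × EuclideanSpace ℝ (Fin n) → ℂ} (hu : MemLp u 2 L'.stMeasure) :
    eLpNorm (transferT M h u) 2 L.stMeasure = eLpNorm u 2 L'.stMeasure := by
  have := sFinite_of_eq hη
  rw [hc.stMeasure_eq] at hu ⊢
  exact (DiscreteOp.isWeightedChange hη hh hM hMpos).eLpNorm_transferT hu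

theorem memDomH_iff (s : ℝ) (u : ℝ × EuclideanSpace ℝ (Fin n) → ℂ) :
    L'.MemDomH s u ↔ L.MemDomH s (transferT M h u) := by
  have := sFinite_of_eq hη
  have H := DiscreteOp.isWeightedChange hη hh hM hMpos
  have : SFinite (L.transferOp hh.isOpen H).η := sFinite_transferMeasure
  rw [← (hc.sameForm hh.isOpen H).memDomH_iff, DiscreteOp.transferOp_memDomH_iff]

theorem pairH_eq (s : ℝ) {u v : ℝ × EuclideanSpace ℝ (Fin n) → ℂ} (hu : L'.MemDomH s u)
    (hv : L'.MemDomH s v) :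
    L'.pairH s u v = L.pairH s (transferT M h u) (transferT M h v) := by
  have H := DiscreteOp.isWeightedChange hη hh hM hMpos
  have : SFinite (L.transferOp hh.isOpen H).η := sFinite_transferMeasure
  rw [← (hc.sameForm hh.isOpen H).pairH_eq s hu hv, DiscreteOp.transferOp_pairH]

theorem zeroMean_transferT {u : ℝ × EuclideanSpace ℝ (Fin n) → ℂ}
    (hu : MemLp u 2 L'.stMeasure) (hz : L'.ZeroMean u) : L.ZeroMean (transferT M h u) := by
  have H := DiscreteOp.isWeightedChange hη hh hM hMpos
  have : SFinite (L.transferOp hh.isOpen H).η := sFinite_transferMeasure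
  have hs := hc.sameForm hh.isOpen H
  rw [← DiscreteOp.transferOp_zeroMean_iff hh.isOpen H]
  exact hs.zeroMean (hs.stMeasure_eq ▸ hu) hz

/-- To test against `v` over `Ω`, test the original equation against `(U ∘ W)⁻¹ v`, an admissible
smooth function with compact support, and move the pairing across. -/
theorem isSolution_transferT {zm : Prop} {s : ℝ} {I : Set ℝ}
    {O : Set (EuclideanSpace ℝ (Fin n))} {u : ℝ × EuclideanSpace ℝ (Fin n) → ℂ}
    (hu : L'.IsSolution zm s (I ×ˢ O) u) :
    L.IsSolution zm s (I ×ˢ (L.Ω ∩ h ⁻¹' O)) (transferT M h u) := by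
  refine ⟨(hc.memDomH_iff hη hh hM hMpos s u).1 hu.1,
    fun hz => hc.zeroMean_transferT hη hh hM hMpos hu.1.1 (hu.2.1 hz), ?_⟩
  intro v hvs hv hvR hvD
  have hvΩ : tsupport v ⊆ univ ×ˢ L.Ω := fun p hp => ⟨mem_univ _, (hvR hp).2.1⟩
  have e : ∀ t, ∀ x ∈ L.Ω, transferT M h (transferInvT Ω' M k v) (t, x) = v (t, x) :=
    fun t x hx => transferT_transferInvT hh hMpos v t hx
  have hD : L'.MemDomH s (transferInvT Ω' M k v) := by
    rw [hc.memDomH_iff hη hh hM hMpos, DiscreteOp.memDomH_congr hη e]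
    exact hvD
  have h0 := hu.2.2 (transferInvT Ω' M k v) (contDiff_transferInvT hh hM hMpos hvs hv hvΩ)
    (hasCompactSupport_transferInvT hh hv hvΩ) (fun p hp => by
      obtain ⟨q, hq, rfl⟩ := tsupport_transferInvT_subset hh hv hvΩ hp
      exact ⟨(hvR hq).1, (hvR hq).2.2⟩) hD
  rw [hc.pairH_eq hη hh hM hMpos s hu.1 hD] at h0
  -- Transferring the pullback returns `v` on `Ω` only, which suffices since the coefficients do not
  -- see the complement.
  rw [← h0, DiscreteOp.pairH, DiscreteOp.pairH, DiscreteOp.tcoeff_congr hη e]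

theorem isSolution_transfer_real {zm : Prop} {s : ℝ} {I : Set ℝ}
    {O : Set (EuclideanSpace ℝ (Fin n))} {u : ℝ × EuclideanSpace ℝ (Fin n) → ℝ}
    (hu : L'.IsSolution zm s (I ×ˢ O) (fun p => (u p : ℂ))) :
    L.IsSolution zm s (I ×ˢ (L.Ω ∩ h ⁻¹' O)) (fun p => ((M p.2 * u (p.1, h p.2) : ℝ) : ℂ)) := by
  convert hc.isSolution_transferT hη hh hM hMpos hu using 2 with p
  rw [transferT]
  push_cast
  rfl

theorem nonnegBefore_transfer {T : ℝ} {u : ℝ × EuclideanSpace ℝ (Fin n) → ℝ}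
    (hu : L'.NonnegBefore T u) : L.NonnegBefore T (fun p => M p.2 * u (p.1, h p.2)) := by
  have := sFinite_of_eq hη
  rw [DiscreteOp.nonnegBefore_iff, hc.domain_eq] at hu
  rw [DiscreteOp.nonnegBefore_iff, ← hη]
  have hac : (volume : Measure ℝ).prod (transferMeasure Ω' M k) ≪
      (volume : Measure ℝ).prod (volume.restrict Ω') :=
    Measure.AbsolutelyContinuous.rfl.prod (withDensity_absolutelyContinuous _ _)
  have H := (DiscreteOp.isWeightedChange hη hh hM hMpos).prod (volume : Measure ℝ)
  filter_upwards [H.ae_of_ae (hac.ae_le hu), H.weight_pos] with p h1 h2 h3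
  exact mul_nonneg h2.le (h1 h3)

end IsConjugate

theorem continuousOn_transfer_real {n : ℕ} {Ω Ω' : Set (EuclideanSpace ℝ (Fin n))}
    {h k : EuclideanSpace ℝ (Fin n) → EuclideanSpace ℝ (Fin n)}
    {M : EuclideanSpace ℝ (Fin n) → ℝ} (hh : IsSmoothChange Ω Ω' h k)
    (hM : ContDiffOn ℝ ∞ M Ω) {I : Set ℝ} {O : Set (EuclideanSpace ℝ (Fin n))}
    {u : ℝ × EuclideanSpace ℝ (Fin n) → ℝ} (hu : ContinuousOn u (I ×ˢ O)) :
    ContinuousOn (fun p => M p.2 * u (p.1, h p.2)) (I ×ˢ (Ω ∩ h ⁻¹' O)) := by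
  have h2 : MapsTo (Prod.snd : ℝ × EuclideanSpace ℝ (Fin n) → _) (I ×ˢ (Ω ∩ h ⁻¹' O)) Ω :=
    fun p hp => hp.2.1
  refine (hM.continuousOn.comp continuousOn_snd h2).mul (hu.comp (continuousOn_fst.prodMk
    (hh.smooth.continuousOn.comp continuousOn_snd h2)) fun p hp => ⟨hp.1, hp.2.2⟩)

/-! ### Bounds on compact sets and the Hölder norm. -/

section CompactBounds

variable {n : ℕ}

/-- The compact set need not be convex, so a derivative bound alone is not enough; local Lipschitz
continuity is upgraded by compactness. -/
theorem exists_lipschitz_bound_on_compact {F : Type*} [NormedAddCommGroup F] [NormedSpace ℝ F]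
    {U K : Set (EuclideanSpace ℝ (Fin n))} (hU : IsOpen U) (hK : IsCompact K) (hKU : K ⊆ U)
    {f : EuclideanSpace ℝ (Fin n) → F} (hf : ContDiffOn ℝ ∞ f U) :
    ∃ A : ℝ, ∀ x ∈ K, ∀ y ∈ K, ‖f x - f y‖ ≤ A * ‖x - y‖ := by
  have h1 : LocallyLipschitzOn K f := by
    intro x hx
    have h2 : ContDiffAt ℝ 1 f x :=
      (hf.contDiffAt (hU.mem_nhds (hKU hx))).of_le (by exact_mod_cast le_top)
    obtain ⟨C, t, ht, hC⟩ := h2.exists_lipschitzOnWith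
    exact ⟨C, t, mem_nhdsWithin_of_mem_nhds ht, hC⟩
  obtain ⟨C, hC⟩ := h1.exists_lipschitzOnWith_of_compact hK
  exact ⟨C, fun x hx y hy => by simpa [dist_eq_norm] using hC.dist_le_mul x hx y hy⟩

theorem exists_weight_bound {U K : Set (EuclideanSpace ℝ (Fin n))} (hK : IsCompact K)
    (hKU : K ⊆ U) {f : EuclideanSpace ℝ (Fin n) → ℝ} (hf : ContinuousOn f U)
    (hpos : ∀ x ∈ U, 0 < f x) : ∃ A : ℝ, 0 < A ∧ ∀ x ∈ K, f x ≤ A ∧ (f x)⁻¹ ≤ A := by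
  obtain ⟨A, hA⟩ := hK.exists_bound_of_continuousOn (hf.mono hKU)
  obtain ⟨B, hB⟩ := hK.exists_bound_of_continuousOn
    ((hf.mono hKU).inv₀ fun x hx => (hpos x (hKU hx)).ne')
  refine ⟨max 1 (max A B), by positivity, fun x hx => ⟨?_, ?_⟩⟩
  · exact (le_abs_self _).trans ((hA x hx).trans ((le_max_left _ _).trans (le_max_right _ _)))
  · exact (le_abs_self _).trans ((hB x hx).trans ((le_max_right _ _).trans (le_max_right _ _)))

end CompactBounds

section HolderNorm

variable {n : ℕ} {α : ℝ} {K : Set (ℝ × EuclideanSpace ℝ (Fin n))}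
  {v : ℝ × EuclideanSpace ℝ (Fin n) → ℂ}

theorem norm_le_of_parabolicHolderNorm (hv : parabolicHolderNorm α K v ≠ ⊤)
    {p : ℝ × EuclideanSpace ℝ (Fin n)} (hp : p ∈ K) :
    ‖v p‖ ≤ (parabolicHolderNorm α K v).toReal := by
  have h1 : ‖v p‖ₑ ≤ parabolicHolderNorm α K v :=
    (le_iSup₂ (f := fun p (_ : p ∈ K) => ‖v p‖ₑ) p hp).trans le_self_add
  rw [← toReal_enorm]
  exact ENNReal.toReal_mono hv h1

theorem norm_sub_le_of_parabolicHolderNorm (hv : parabolicHolderNorm α K v ≠ ⊤)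
    {p q : ℝ × EuclideanSpace ℝ (Fin n)} (hp : p ∈ K) (hq : q ∈ K) :
    ‖v p - v q‖ ≤ (parabolicHolderNorm α K v).toReal *
      (|p.1 - q.1| ^ (α / 2) + ‖p.2 - q.2‖ ^ α) := by
  have h1 : ‖v p - v q‖ₑ / ENNReal.ofReal (|p.1 - q.1| ^ (α / 2) + ‖p.2 - q.2‖ ^ α) ≤
      parabolicHolderNorm α K v := by
    refine le_trans ?_ le_add_self
    refine le_trans ?_ (le_iSup₂ (f := fun p (_ : p ∈ K) => ⨆ q ∈ K,
      ‖v p - v q‖ₑ / ENNReal.ofReal (|p.1 - q.1| ^ (α / 2) + ‖p.2 - q.2‖ ^ α)) p hp)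
    exact le_iSup₂ (f := fun q (_ : q ∈ K) =>
      ‖v p - v q‖ₑ / ENNReal.ofReal (|p.1 - q.1| ^ (α / 2) + ‖p.2 - q.2‖ ^ α)) q hq
  rw [ENNReal.div_le_iff_le_mul (Or.inr hv) (Or.inl ENNReal.ofReal_ne_top)] at h1
  have h2 := ENNReal.toReal_mono (ENNReal.mul_ne_top hv ENNReal.ofReal_ne_top) h1
  rwa [toReal_enorm, ENNReal.toReal_mul, ENNReal.toReal_ofReal (by positivity)] at h2

theorem parabolicHolderNorm_le {A B : ℝ} (hA : 0 ≤ A) (hB : 0 ≤ B) (h1 : ∀ p ∈ K, ‖v p‖ ≤ A)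
    (h2 : ∀ p ∈ K, ∀ q ∈ K,
      ‖v p - v q‖ ≤ B * (|p.1 - q.1| ^ (α / 2) + ‖p.2 - q.2‖ ^ α)) :
    parabolicHolderNorm α K v ≤ ENNReal.ofReal (A + B) := by
  rw [ENNReal.ofReal_add hA hB]
  refine add_le_add (iSup₂_le fun p hp => ?_) (iSup₂_le fun p hp => iSup₂_le fun q hq => ?_)
  · rw [← ofReal_norm]
    exact ENNReal.ofReal_le_ofReal (h1 p hp)
  · refine ENNReal.div_le_of_le_mul ?_
    rw [← ENNReal.ofReal_mul hB, ← ofReal_norm]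
    exact ENNReal.ofReal_le_ofReal (h2 p hp q hq)

/-- The product difference splits into `m(p)(v - v)` and `(m(p) - m(q)) v`. Time is untouched, and
Lipschitz bounds in space become `α`-Hölder bounds because distances in `K` are at most `A`. -/
theorem parabolicHolderNorm_transfer_le (hα : α ∈ Ioo (0 : ℝ) 1)
    {k : EuclideanSpace ℝ (Fin n) → EuclideanSpace ℝ (Fin n)}
    {m : EuclideanSpace ℝ (Fin n) → ℝ} {A : ℝ} (hA : 1 ≤ A)
    (hm : ∀ p ∈ K, |m p.2| ≤ A)
    (hmL : ∀ p ∈ K, ∀ q ∈ K, |m p.2 - m q.2| ≤ A * ‖p.2 - q.2‖)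
    (hkL : ∀ p ∈ K, ∀ q ∈ K, ‖k p.2 - k q.2‖ ≤ A * ‖p.2 - q.2‖)
    (hd : ∀ p ∈ K, ∀ q ∈ K, ‖p.2 - q.2‖ ≤ A)
    (hv : parabolicHolderNorm α (Prod.map id k '' K) v ≠ ⊤) :
    parabolicHolderNorm α K (fun p => (m p.2 : ℂ) * v (p.1, k p.2)) ≤
      ENNReal.ofReal (A + 2 * A ^ 2) * parabolicHolderNorm α (Prod.map id k '' K) v := by
  obtain ⟨hα0, hα1⟩ := hα
  have hA0 : 0 ≤ A := zero_le_one.trans hA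
  have hpow : ∀ β ≤ (1 : ℝ), A ^ β ≤ A := fun β hβ => by
    simpa using Real.rpow_le_rpow_of_exponent_le hA hβ
  set a := (parabolicHolderNorm α (Prod.map id k '' K) v).toReal with ha
  have ha0 : 0 ≤ a := ENNReal.toReal_nonneg
  have hmem : ∀ p ∈ K, (p.1, k p.2) ∈ Prod.map id k '' K := fun p hp => ⟨p, hp, rfl⟩
  have e : ENNReal.ofReal (A + 2 * A ^ 2) * parabolicHolderNorm α (Prod.map id k '' K) v =
      ENNReal.ofReal (A * a + 2 * A ^ 2 * a) := by
    rw [← ENNReal.ofReal_toReal hv, ← ENNReal.ofReal_mul (by positivity), ← ha, add_mul]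
  rw [e]
  refine parabolicHolderNorm_le (by positivity) (by positivity) (fun p hp => ?_)
    fun p hp q hq => ?_
  · rw [norm_mul, Complex.norm_real, Real.norm_eq_abs]
    exact mul_le_mul (hm p hp) (norm_le_of_parabolicHolderNorm hv (hmem p hp)) (norm_nonneg _) hA0
  · have h1 := norm_sub_le_of_parabolicHolderNorm hv (hmem p hp) (hmem q hq)
    have h2 := norm_le_of_parabolicHolderNorm hv (hmem q hq)
    simp only [← ha] at h1 h2
    set x := ‖p.2 - q.2‖ with hx
    have hx0 : 0 ≤ x := norm_nonneg _
    set τ := |p.1 - q.1| ^ (α / 2) with hτ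
    have hτ0 : 0 ≤ τ := by positivity
    have hxα : 0 ≤ x ^ α := by positivity
    have h3 : ‖k p.2 - k q.2‖ ^ α ≤ A * x ^ α := by
      calc ‖k p.2 - k q.2‖ ^ α ≤ (A * x) ^ α :=
            Real.rpow_le_rpow (norm_nonneg _) (hkL p hp q hq) hα0.le
        _ = A ^ α * x ^ α := Real.mul_rpow hA0 hx0
        _ ≤ A * x ^ α := by gcongr; exact hpow α hα1.le
    -- Here `x = x^(1-α) x^α` with `x ≤ A`, and `A^(1-α) ≤ A` since `A ≥ 1`.
    have h4 : x ≤ A * x ^ α := by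
      rcases hx0.eq_or_lt with h0 | h0
      · rw [← h0, Real.zero_rpow hα0.ne', mul_zero]
      · calc x = x ^ (1 - α) * x ^ α := by rw [← Real.rpow_add h0]; simp
          _ ≤ A ^ (1 - α) * x ^ α := mul_le_mul_of_nonneg_right
              (Real.rpow_le_rpow hx0 (hd p hp q hq) (by linarith)) hxα
          _ ≤ A * x ^ α := by gcongr; exact hpow _ (by linarith)
    have h5 : (m p.2 : ℂ) * v (p.1, k p.2) - (m q.2 : ℂ) * v (q.1, k q.2) =
        (m p.2 : ℂ) * (v (p.1, k p.2) - v (q.1, k q.2)) +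
          ((m p.2 - m q.2 : ℝ) : ℂ) * v (q.1, k q.2) := by
      push_cast
      ring
    rw [h5]
    calc ‖(m p.2 : ℂ) * (v (p.1, k p.2) - v (q.1, k q.2)) +
          ((m p.2 - m q.2 : ℝ) : ℂ) * v (q.1, k q.2)‖
        ≤ |m p.2| * ‖v (p.1, k p.2) - v (q.1, k q.2)‖ + |m p.2 - m q.2| * ‖v (q.1, k q.2)‖ := by
          refine (norm_add_le _ _).trans (le_of_eq ?_)
          rw [norm_mul, norm_mul, Complex.norm_real, Complex.norm_real, Real.norm_eq_abs,
            Real.norm_eq_abs]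
      _ ≤ A * (a * (τ + A * x ^ α)) + A * (A * x ^ α) * a := by
          refine add_le_add (mul_le_mul (hm p hp) (h1.trans ?_) (norm_nonneg _) hA0)
            (mul_le_mul ((hmL p hp q hq).trans ?_) h2 (norm_nonneg _) (by positivity))
          · exact mul_le_mul_of_nonneg_left (add_le_add le_rfl h3) ha0
          · exact mul_le_mul_of_nonneg_left h4 hA0
      _ ≤ 2 * A ^ 2 * a * (τ + x ^ α) := by
          -- This is exactly the difference of the two sides: the spatial terms agree, and the time
          -- term has coefficient `A a` against `2 A² a`.
          have h6 : 0 ≤ A * a * τ * (2 * A - 1) := by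
            have : 0 ≤ 2 * A - 1 := by linarith
            positivity
          nlinarith [h6]

end HolderNorm

/-! ### Interior Harnack and Hölder estimates. -/

namespace IsConjugate

variable {n : ℕ} {L L' : DiscreteOp n} {Ω' : Set (EuclideanSpace ℝ (Fin n))}
  {h k : EuclideanSpace ℝ (Fin n) → EuclideanSpace ℝ (Fin n)}
  {M : EuclideanSpace ℝ (Fin n) → ℝ}

theorem isOpen_preimage_inter {Ω : Set (EuclideanSpace ℝ (Fin n))} (hh : IsSmoothChange Ω Ω' h k)
    (hΩ : IsOpen Ω) {O : Set (EuclideanSpace ℝ (Fin n))} (hO : IsOpen O) :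
    IsOpen (Ω ∩ h ⁻¹' O) :=
  hh.smooth.continuousOn.isOpen_inter_preimage hΩ hO

variable (hc : IsConjugate L L' Ω' M h k) (hη : L.η = volume.restrict L.Ω)
  (hh : IsSmoothChange L.Ω Ω' h k) (hM : ContDiffOn ℝ ∞ M L.Ω) (hMpos : ∀ x ∈ L.Ω, 0 < M x)
include hc hη hh hM hMpos

/-- The inequality for `M · (u ∘ h)` on `k(J)` is read back at `y = h(x)`. Bounding `M` above at `q`
and `1/M` at `p` costs one factor `A` each. -/
theorem interiorHarnack {zm : Prop} {s : ℝ} (hL : L.InteriorHarnack zm s) :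
    L'.InteriorHarnack zm s := by
  intro O J hO hOΩ hJ hJO
  have hΩ := hc.domain_eq
  rw [hΩ] at hOΩ
  have hmem : ∀ y ∈ J, k y ∈ L.Ω ∩ h ⁻¹' O := fun y hy =>
    ⟨hh.mapsTo_inv (hOΩ (hJO hy)), by rw [mem_preimage, hh.invOn.2 (hOΩ (hJO hy))]; exact hJO hy⟩
  have hkJ : k '' J ⊆ L.Ω ∩ h ⁻¹' O := image_subset_iff.2 hmem
  have hkJc : IsCompact (k '' J) :=
    hJ.image_of_continuousOn (hh.smooth_inv.continuousOn.mono (hJO.trans hOΩ))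
  obtain ⟨C, hC0, hC⟩ := hL _ _ (isOpen_preimage_inter hh L.isOpen hO) inter_subset_left hkJc hkJ
  obtain ⟨A, hA0, hA⟩ := exists_weight_bound hkJc (hkJ.trans inter_subset_left) hM.continuousOn
    hMpos
  refine ⟨A * C * A, by positivity, fun u hu hpos hcont p hp q hq => ?_⟩
  -- The sign is needed to replace `M(k q) u(q)` by `A u(q)`.
  have hq0 : 0 ≤ u q := hpos.nonneg (O := O) isOpen_Ioo hO (fun t ht => ht.2) (hΩ ▸ hOΩ) hcont
    ⟨⟨by linarith [hq.1.1], hq.1.2⟩, hJO hq.2⟩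
  have h1 := hC _ (hc.isSolution_transfer_real hη hh hM hMpos hu)
    (hc.nonnegBefore_transfer hη hh hM hMpos hpos) (continuousOn_transfer_real hh hM hcont)
    (p.1, k p.2) ⟨hp.1, mem_image_of_mem k hp.2⟩ (q.1, k q.2) ⟨hq.1, mem_image_of_mem k hq.2⟩
  simp only [hh.invOn.2 (hOΩ (hJO hp.2)), hh.invOn.2 (hOΩ (hJO hq.2)), Prod.mk.eta] at h1
  have hMp : 0 < M (k p.2) := hMpos _ (hmem _ hp.2).1
  have h2 : 0 ≤ C * (A * u q) := by positivity
  calc u p = (M (k p.2))⁻¹ * (M (k p.2) * u p) := by rw [inv_mul_cancel_left₀ hMp.ne']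
    _ ≤ (M (k p.2))⁻¹ * (C * (A * u q)) :=
        mul_le_mul_of_nonneg_left (h1.trans (mul_le_mul_of_nonneg_left
          (mul_le_mul_of_nonneg_right (hA _ (mem_image_of_mem k hq.2)).1 hq0) hC0.le))
          (inv_nonneg.2 hMp.le)
    _ ≤ A * (C * (A * u q)) :=
        mul_le_mul_of_nonneg_right (hA _ (mem_image_of_mem k hp.2)).2 h2
    _ = A * C * A * u q := by ring

/-- The required version of `u` is `v ∘ k / (M ∘ k)`, with `v` the continuous version of the
transferred solution; the `L²` norms agree because the transfer is an isometry. -/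
theorem interiorHolder {zm : Prop} {s α : ℝ} (hα : α ∈ Ioo (0 : ℝ) 1)
    (hL : L.InteriorHolder zm s α) : L'.InteriorHolder zm s α := by
  intro O hO hOΩ K hK hKO
  rw [hc.domain_eq] at hOΩ
  have hk2 : IsCompact (Prod.snd '' K) := hK.image continuous_snd
  have hk2Ω : Prod.snd '' K ⊆ Ω' := by
    rintro _ ⟨p, hp, rfl⟩
    exact hOΩ (hKO hp).2
  have hmaps : ∀ p ∈ Ioo (0 : ℝ) 1 ×ˢ O, (p.1, k p.2) ∈ Ioo (0 : ℝ) 1 ×ˢ (L.Ω ∩ h ⁻¹' O) :=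
    fun p hp => ⟨hp.1, hh.mapsTo_inv (hOΩ hp.2), by
      rw [mem_preimage, hh.invOn.2 (hOΩ hp.2)]; exact hp.2⟩
  have hcontk : ContinuousOn (Prod.map id k) (Ioo (0 : ℝ) 1 ×ˢ O) :=
    continuousOn_fst.prodMk (hh.smooth_inv.continuousOn.comp continuousOn_snd
      fun p hp => hOΩ hp.2)
  have hcontm : ContinuousOn (fun p : ℝ × EuclideanSpace ℝ (Fin n) => (M (k p.2))⁻¹)
      (Ioo (0 : ℝ) 1 ×ˢ O) :=
    (contDiffOn_inv_weight hh hM hMpos).continuousOn.comp continuousOn_snd fun p hp => hOΩ hp.2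
  obtain ⟨C, hC⟩ := hL _ (isOpen_preimage_inter hh L.isOpen hO) inter_subset_left
    (Prod.map id k '' K) (hK.image_of_continuousOn (hcontk.mono hKO))
    (image_subset_iff.2 fun p hp => hmaps p (hKO hp))
  obtain ⟨A₁, hA₁⟩ := hk2.exists_bound_of_continuousOn
    ((contDiffOn_inv_weight hh hM hMpos).continuousOn.mono hk2Ω)
  obtain ⟨A₂, hA₂⟩ := exists_lipschitz_bound_on_compact hh.isOpen hk2 hk2Ω
    (contDiffOn_inv_weight hh hM hMpos)
  obtain ⟨A₃, hA₃⟩ := exists_lipschitz_bound_on_compact hh.isOpen hk2 hk2Ω hh.smooth_inv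
  obtain ⟨A₄, hA₄⟩ := Metric.isBounded_iff.1 hk2.isBounded
  obtain ⟨A, hA1, hAA₁, hAA₂, hAA₃, hAA₄⟩ :
      ∃ A : ℝ, 1 ≤ A ∧ A₁ ≤ A ∧ A₂ ≤ A ∧ A₃ ≤ A ∧ A₄ ≤ A :=
    ⟨max 1 (max (max A₁ A₂) (max A₃ A₄)), by simp⟩
  refine ⟨Real.toNNReal (A + 2 * A ^ 2) * C, fun u hu => ?_⟩
  obtain ⟨v, hvu, hvc, hvn⟩ := hC _ (hc.isSolution_transferT hη hh hM hMpos hu)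
  have huL : MemLp u 2 L'.stMeasure := hu.1.1
  rw [hc.eLpNorm_transferT hη hh hM hMpos huL] at hvn
  -- Finiteness comes from the estimate itself and allows passage to real numbers.
  have hvtop : parabolicHolderNorm α (Prod.map id k '' K) v ≠ ⊤ :=
    (hvn.trans_lt (ENNReal.mul_lt_top ENNReal.coe_lt_top huL.2)).ne
  refine ⟨fun p => (((M (k p.2))⁻¹ : ℝ) : ℂ) * v (p.1, k p.2), ?_, ?_, ?_⟩
  · have := sFinite_of_eq hη
    have H := (DiscreteOp.isWeightedChange hη hh hM hMpos).prod (volume : Measure ℝ)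
    rw [hc.stMeasure_eq]
    filter_upwards [H.ae_inv_of_ae hvu, H.ae_inv_of_ae H.weight_pos, H.right_inv] with p h1 h2 h3
    change 0 < M (k p.2) at h2
    change v (p.1, k p.2) = (M (k p.2) : ℂ) * u (Prod.map id h (Prod.map id k p)) at h1
    rw [h1, h3, ← mul_assoc, ← Complex.ofReal_mul, inv_mul_cancel₀ h2.ne', Complex.ofReal_one,
      one_mul]
  · exact (Complex.continuous_ofReal.comp_continuousOn hcontm).mul (hvc.comp hcontk hmaps)
  · refine (parabolicHolderNorm_transfer_le hα (m := fun y => (M (k y))⁻¹) hA1 ?_ ?_ ?_ ?_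
      hvtop).trans ?_
    · exact fun p hp => (hA₁ _ (mem_image_of_mem _ hp)).trans hAA₁
    · exact fun p hp q hq => (hA₂ _ (mem_image_of_mem _ hp) _ (mem_image_of_mem _ hq)).trans
        (mul_le_mul_of_nonneg_right hAA₂ (norm_nonneg _))
    · exact fun p hp q hq => (hA₃ _ (mem_image_of_mem _ hp) _ (mem_image_of_mem _ hq)).trans
        (mul_le_mul_of_nonneg_right hAA₃ (norm_nonneg _))
    · exact fun p hp q hq => by
        rw [← dist_eq_norm]
        exact (hA₄ (mem_image_of_mem _ hp) (mem_image_of_mem _ hq)).trans hAA₄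
    · rw [ENNReal.coe_mul, mul_assoc]
      exact mul_le_mul_right hvn _

end IsConjugate

/-! ### Lipschitz boundaries under diffeomorphisms. -/

section LipschitzBoundary

variable {E : Type*} [NormedAddCommGroup E] [InnerProductSpace ℝ E]

theorem sub_inner_smul_sub (e x y : E) :
    (x - inner ℝ e x • e) - (y - inner ℝ e y • e) = (x - y) - inner ℝ e (x - y) • e := by
  rw [inner_sub_right, sub_smul]
  abel

theorem norm_sub_inner_smul_le {e : E} (he : ‖e‖ = 1) (x : E) :
    ‖x - inner ℝ e x • e‖ ≤ 2 * ‖x‖ := by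
  have h1 : |inner ℝ e x| ≤ ‖x‖ := by simpa [he] using abs_real_inner_le_norm e x
  calc ‖x - inner ℝ e x • e‖ ≤ ‖x‖ + ‖inner ℝ e x • e‖ := norm_sub_le _ _
    _ ≤ ‖x‖ + ‖x‖ := by rw [norm_smul, he, mul_one, Real.norm_eq_abs]; gcongr
    _ = 2 * ‖x‖ := by ring

/-- An open set that is stable under translation by an open cone is locally the region above a
Lipschitz graph. -/
theorem exists_lipschitz_graph_of_cone {S : Set E} (hS : IsOpen S) {z e : E} {r : ℝ}
    (hne : (S ∩ Metric.ball z r).Nonempty) (he : ‖e‖ = 1) (κ : ℝ≥0)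
    (hcone : ∀ x ∈ Metric.ball z r, ∀ y ∈ S ∩ Metric.ball z r,
      κ * ‖(x - y) - inner ℝ e (x - y) • e‖ < inner ℝ e (x - y) → x ∈ S) :
    ∃ g : E → ℝ, LipschitzWith κ g ∧ ∀ x ∈ Metric.ball z r,
      x ∈ S ↔ g (x - inner ℝ e x • e) < inner ℝ e x := by
  have : Nonempty ↑(S ∩ Metric.ball z r) := hne.to_subtype
  -- The graph will be the lower envelope of the upward cones of slope `κ` with apex at the points
  -- `y` of `S` in the ball; an infimum of `κ`-Lipschitz functions is `κ`-Lipschitz.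
  let f : E → ↑(S ∩ Metric.ball z r) → ℝ := fun w y =>
    inner ℝ e (y : E) + κ * ‖w - ((y : E) - inner ℝ e (y : E) • e)‖
  have hbdd : ∀ w, BddBelow (range (f w)) := by
    intro w
    refine ⟨-(‖z‖ + r), ?_⟩
    rintro _ ⟨y, rfl⟩
    have h1 : |inner ℝ e (y : E)| ≤ ‖(y : E)‖ := by
      simpa [he] using abs_real_inner_le_norm e (y : E)
    have h2 : ‖(y : E)‖ ≤ ‖z‖ + r := by
      have h3 := y.2.2
      rw [mem_ball_iff_norm] at h3
      linarith [norm_le_norm_add_norm_sub' (y : E) z]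
    have h4 : 0 ≤ κ * ‖w - ((y : E) - inner ℝ e (y : E) • e)‖ := by positivity
    change _ ≤ inner ℝ e (y : E) + κ * ‖w - ((y : E) - inner ℝ e (y : E) • e)‖
    linarith [neg_abs_le (inner ℝ e (y : E))]
  refine ⟨fun w => ⨅ y, f w y, LipschitzWith.of_le_add_mul κ fun w w' => ?_, fun x hx => ⟨?_, ?_⟩⟩
  · rw [← sub_le_iff_le_add]
    refine le_ciInf fun y => ?_
    have h1 := ciInf_le (hbdd w) y
    have h2 : ‖w - ((y : E) - inner ℝ e (y : E) • e)‖ ≤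
        dist w w' + ‖w' - ((y : E) - inner ℝ e (y : E) • e)‖ := by
      rw [dist_eq_norm]
      exact norm_sub_le_norm_sub_add_norm_sub _ _ _
    have h3 := mul_le_mul_of_nonneg_left h2 κ.2
    change _ ≤ inner ℝ e (y : E) + κ * ‖w' - ((y : E) - inner ℝ e (y : E) • e)‖
    change _ ≤ inner ℝ e (y : E) + κ * ‖w - ((y : E) - inner ℝ e (y : E) • e)‖ at h1
    rw [mul_add] at h3
    change (κ : ℝ) * _ ≤ κ * _ + κ * _ at h3
    linarith
  · intro hxS
    -- Openness allows a small move down from `x` along `e` inside `S`; the cone at that lower point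
    -- lies strictly below `x`.
    have hcont : Filter.Tendsto (fun τ : ℝ => x - τ • e) (nhdsWithin 0 (Ioi 0)) (nhds x) := by
      have : Continuous fun τ : ℝ => x - τ • e := by fun_prop
      simpa using (this.tendsto 0).mono_left nhdsWithin_le_nhds
    obtain ⟨τ, hτ, hτ0⟩ := ((hcont.eventually ((hS.inter Metric.isOpen_ball).mem_nhds
      ⟨hxS, hx⟩)).and self_mem_nhdsWithin).exists
    refine (ciInf_le (hbdd _) ⟨_, hτ⟩).trans_lt ?_
    have h1 : inner ℝ e (x - τ • e) = inner ℝ e x - τ := by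
      rw [inner_sub_right, inner_smul_right, real_inner_self_eq_norm_sq, he]
      ring
    change inner ℝ e (x - τ • e) + κ * ‖(x - inner ℝ e x • e) -
      ((x - τ • e) - inner ℝ e (x - τ • e) • e)‖ < inner ℝ e x
    have h2 : (x - inner ℝ e x • e) - ((x - τ • e) - inner ℝ e (x - τ • e) • e) = 0 := by
      rw [h1, sub_smul]
      abel
    rw [h2, h1, norm_zero, mul_zero, add_zero]
    exact sub_lt_self _ hτ0
  · intro hlt
    obtain ⟨y, hy⟩ := exists_lt_of_ciInf_lt hlt
    change inner ℝ e (y : E) + κ * ‖(x - inner ℝ e x • e) -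
      ((y : E) - inner ℝ e (y : E) • e)‖ < inner ℝ e x at hy
    rw [sub_inner_smul_sub] at hy
    refine hcone x hx y y.2 ?_
    rw [inner_sub_right e x (y : E)] at hy ⊢
    linarith

/-- The preimage of the region above a Lipschitz graph under a map with invertible strict
derivative is stable under translation by an open cone. -/
theorem exists_cone_of_hasStrictFDerivAt {h : E → E} {A : E →L[ℝ] E} {z e b : E}
    (hA : HasStrictFDerivAt h A z) (he : ‖e‖ = 1) (hb : A b = e) {κ : ℝ≥0} {g : E → ℝ}
    (hg : LipschitzWith κ g) :
    ∃ e' : E, ‖e'‖ = 1 ∧ ∃ κ' : ℝ≥0, ∃ r > 0, ∀ x ∈ Metric.ball z r, ∀ y ∈ Metric.ball z r,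
      κ' * ‖(x - y) - inner ℝ e' (x - y) • e'‖ < inner ℝ e' (x - y) →
      g (h y - inner ℝ e (h y) • e) < inner ℝ e (h y) →
      g (h x - inner ℝ e (h x) • e) < inner ℝ e (h x) := by
  have hb0 : b ≠ 0 := by
    rintro rfl
    rw [map_zero] at hb
    rw [← hb, norm_zero] at he
    exact zero_ne_one he
  have hbn : 0 < ‖b‖ := norm_pos_iff.2 hb0
  obtain ⟨c, hc⟩ : ∃ c, c = ‖b‖⁻¹ := ⟨_, rfl⟩
  have hc0 : 0 < c := hc ▸ inv_pos.2 hbn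
  -- A deviation `w` from the vertical motion `cτ e` costs at most `‖w‖` in height and `2κ‖w‖` in
  -- the graph, `D‖w‖` in all, which must stay below `cτ`. The choice of `δ` makes the linearisation
  -- error contribute at most `cτ/4`.
  set D : ℝ := 1 + 2 * κ with hD
  have hD0 : 0 < D := by positivity
  set δ : ℝ := c / (8 * D) with hδ
  have hδ0 : 0 < δ := by positivity
  have hDδ : D * δ = c / 8 := by rw [hδ]; field_simp
  have h1 := hA.isLittleO.def hδ0
  obtain ⟨r, hr0, hr⟩ := Metric.eventually_nhds_iff_ball.1 h1
  have he' : ‖c • b‖ = 1 := by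
    rw [norm_smul, hc, norm_inv, norm_norm, inv_mul_cancel₀ hbn.ne']
  -- The axis is the normalised preimage of `e`, so `A` maps it to `c e`. In the slope, the summand
  -- `1` gives `‖π‖ ≤ τ`, and the rest bounds the lateral contribution `D‖A‖‖π‖` by `cτ/2`; together
  -- with the error this makes `3cτ/4`.
  refine ⟨c • b, he', ⟨1 + 2 * D * ‖A‖ / c, by positivity⟩, r, hr0, fun x hx y hy hxy hgy => ?_⟩
  set e' := c • b with he'def
  have hAe' : A e' = c • e := by rw [he'def, map_smul, hb]
  set τ := inner ℝ e' (x - y) with hτ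
  set π := (x - y) - τ • e' with hπ
  change (1 + 2 * D * ‖A‖ / c) * ‖π‖ < τ at hxy
  have hπ0 : 0 ≤ ‖π‖ := norm_nonneg _
  have hτ0 : 0 < τ := lt_of_le_of_lt (by positivity) hxy
  have hq : 0 ≤ 2 * D * ‖A‖ / c * ‖π‖ := by positivity
  have hπτ : ‖π‖ ≤ τ := by linarith
  have hAπ : D * (‖A‖ * ‖π‖) ≤ c * τ / 2 := by
    have h2 : 2 * D * ‖A‖ / c * ‖π‖ ≤ τ := by linarith
    have h3 := mul_le_mul_of_nonneg_left h2 hc0.le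
    have h4 : c * (2 * D * ‖A‖ / c * ‖π‖) = 2 * (D * (‖A‖ * ‖π‖)) := by field_simp
    linarith
  have hξ : x - y = τ • e' + π := by rw [hπ]; abel
  have hξn : ‖x - y‖ ≤ 2 * τ := by
    calc ‖x - y‖ ≤ ‖τ • e'‖ + ‖π‖ := by rw [hξ]; exact norm_add_le _ _
      _ ≤ 2 * τ := by rw [norm_smul, he', Real.norm_of_nonneg hτ0.le]; linarith
  have herr : ‖h x - h y - A (x - y)‖ ≤ δ * ‖x - y‖ := hr (x, y) (by
    rw [← ball_prod_same]
    exact ⟨hx, hy⟩)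
  set w := h x - h y - (c * τ) • e with hw
  have hwn : D * ‖w‖ ≤ 3 / 4 * (c * τ) := by
    have h2 : w = (h x - h y - A (x - y)) + A π := by
      rw [hw, hξ, map_add, map_smul, hAe', smul_smul, mul_comm τ c]
      abel
    have h3 : ‖w‖ ≤ δ * (2 * τ) + ‖A‖ * ‖π‖ := by
      rw [h2]
      refine (norm_add_le _ _).trans (add_le_add (herr.trans ?_) (A.le_opNorm π))
      gcongr
    calc D * ‖w‖ ≤ D * (δ * (2 * τ) + ‖A‖ * ‖π‖) := by gcongr
      _ = D * δ * (2 * τ) + D * (‖A‖ * ‖π‖) := by ring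
      _ ≤ 3 / 4 * (c * τ) := by rw [hDδ]; linarith
  have hxw : h x - h y = (c * τ) • e + w := by rw [hw]; abel
  have hin : inner ℝ e (h x - h y) = c * τ + inner ℝ e w := by
    rw [hxw, inner_add_right, inner_smul_right, real_inner_self_eq_norm_sq, he]
    ring
  have hQ : ‖(h x - h y) - inner ℝ e (h x - h y) • e‖ ≤ 2 * ‖w‖ := by
    have h2 : (h x - h y) - inner ℝ e (h x - h y) • e = w - inner ℝ e w • e := by
      rw [hin, hxw, add_smul]
      abel
    rw [h2]
    exact norm_sub_inner_smul_le he w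
  have hgL : g (h x - inner ℝ e (h x) • e) ≤ g (h y - inner ℝ e (h y) • e) + κ * (2 * ‖w‖) := by
    have h2 := hg.dist_le_mul (h x - inner ℝ e (h x) • e) (h y - inner ℝ e (h y) • e)
    rw [dist_eq_norm, dist_eq_norm, sub_inner_smul_sub, Real.norm_eq_abs] at h2
    have h3 := mul_le_mul_of_nonneg_left hQ κ.2
    change (κ : ℝ) * _ ≤ κ * _ at h3
    linarith [le_abs_self (g (h x - inner ℝ e (h x) • e) - g (h y - inner ℝ e (h y) • e))]
  have hiw : |inner ℝ e w| ≤ ‖w‖ := by simpa [he] using abs_real_inner_le_norm e w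
  rw [inner_sub_right] at hin
  have hcτ : 0 < c * τ := by positivity
  have hDw : D * ‖w‖ = ‖w‖ + κ * (2 * ‖w‖) := by rw [hD]; ring
  linarith [neg_abs_le (inner ℝ e w)]

variable {n : ℕ} {Ω Ω' : Set (EuclideanSpace ℝ (Fin n))}
  {h k : EuclideanSpace ℝ (Fin n) → EuclideanSpace ℝ (Fin n)}

theorem IsSmoothChange.mem_frontier (hh : IsSmoothChange Ω Ω' h k) (hΩ : IsOpen Ω)
    {Ω₀ : Set (EuclideanSpace ℝ (Fin n))} (hΩ₀ : IsOpen Ω₀) {z : EuclideanSpace ℝ (Fin n)}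
    (hz : z ∈ Ω) (hzf : z ∈ frontier (Ω ∩ h ⁻¹' Ω₀)) : h z ∈ frontier Ω₀ := by
  rw [(hh.smooth.continuousOn.isOpen_inter_preimage hΩ hΩ₀).frontier_eq] at hzf
  rw [hΩ₀.frontier_eq]
  refine ⟨?_, fun h0 => hzf.2 ⟨hz, h0⟩⟩
  have hcont : ContinuousAt h z := hh.smooth.continuousOn.continuousAt (hΩ.mem_nhds hz)
  exact closure_mono (image_subset_iff.2 inter_subset_right)
    (hcont.continuousWithinAt.mem_closure_image hzf.1)

theorem IsSmoothChange.exists_fderiv_eq (hh : IsSmoothChange Ω Ω' h k) (hΩ : IsOpen Ω)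
    {z : EuclideanSpace ℝ (Fin n)} (hz : z ∈ Ω) (e : EuclideanSpace ℝ (Fin n)) :
    ∃ b, fderiv ℝ h z b = e := by
  have h1 := (hh.symm hΩ).fderiv_comp hh.isOpen (hh.mapsTo hz)
  rw [hh.invOn.1 hz] at h1
  exact ⟨fderiv ℝ k (h z) e, DFunLike.congr_fun h1 e⟩

theorem IsSmoothChange.exists_local_cone (hh : IsSmoothChange Ω Ω' h k) (hΩ : IsOpen Ω)
    {Ω₀ : Set (EuclideanSpace ℝ (Fin n))} {z e : EuclideanSpace ℝ (Fin n)} (hz : z ∈ Ω)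
    {ε : ℝ} (hε : 0 < ε) (he : ‖e‖ = 1) {κ : ℝ≥0} {g : EuclideanSpace ℝ (Fin n) → ℝ}
    (hg : LipschitzWith κ g)
    (hgr : ∀ x ∈ Metric.ball (h z) ε, x ∈ Ω₀ ↔ g (x - inner ℝ e x • e) < inner ℝ e x) :
    ∃ e' : EuclideanSpace ℝ (Fin n), ‖e'‖ = 1 ∧ ∃ κ' : ℝ≥0, ∃ r > 0,
      ∀ x ∈ Metric.ball z r, ∀ y ∈ (Ω ∩ h ⁻¹' Ω₀) ∩ Metric.ball z r,
        κ' * ‖(x - y) - inner ℝ e' (x - y) • e'‖ < inner ℝ e' (x - y) → x ∈ Ω ∩ h ⁻¹' Ω₀ := by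
  have hstrict : HasStrictFDerivAt h (fderiv ℝ h z) z :=
    (hh.smooth.contDiffAt (hΩ.mem_nhds hz)).hasStrictFDerivAt (by simp)
  obtain ⟨b, hb⟩ := hh.exists_fderiv_eq hΩ hz e
  obtain ⟨e', he', κ', r, hr, hcone⟩ := exists_cone_of_hasStrictFDerivAt hstrict he hb hg
  have hnhds : Ω ∩ h ⁻¹' Metric.ball (h z) ε ∈ nhds z :=
    Filter.inter_mem (hΩ.mem_nhds hz)
      (hstrict.continuousAt.preimage_mem_nhds (Metric.ball_mem_nhds _ hε))
  obtain ⟨r', hr', hball⟩ := Metric.mem_nhds_iff.1 hnhds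
  have hsub : ∀ x ∈ Metric.ball z (min r r'), x ∈ Ω ∩ h ⁻¹' Metric.ball (h z) ε := fun x hx =>
    hball (Metric.ball_subset_ball (min_le_right _ _) hx)
  refine ⟨e', he', κ', min r r', lt_min hr hr', fun x hx y hy hxy => ?_⟩
  refine ⟨(hsub x hx).1, (hgr _ (hsub x hx).2).2 ?_⟩
  exact hcone x (Metric.ball_subset_ball (min_le_left _ _) hx) y
    (Metric.ball_subset_ball (min_le_left _ _) hy.2) hxy ((hgr _ (hsub y hy.2).2).1 hy.1.2)

/-- The graph is not transported directly: its cone condition is pulled back through the derivative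
of `h`, and a new graph, over a new axis, is rebuilt from the resulting cone. -/
theorem HasLipschitzBoundaryIn.preimage (hh : IsSmoothChange Ω Ω' h k) (hΩ : IsOpen Ω)
    {Ω₀ N : Set (EuclideanSpace ℝ (Fin n))} (hΩ₀ : IsOpen Ω₀)
    (hL : HasLipschitzBoundaryIn Ω₀ N) :
    HasLipschitzBoundaryIn (Ω ∩ h ⁻¹' Ω₀) (Ω ∩ h ⁻¹' N) := by
  intro z hz
  have hzf := hz.1
  obtain ⟨ε, e, κ, g, hε, he, hg, hgr⟩ :=
    hL (h z) ⟨hh.mem_frontier hΩ hΩ₀ hz.2.1 hzf, hz.2.2⟩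
  obtain ⟨e', he', κ', r, hr, hcone⟩ := hh.exists_local_cone hΩ hz.2.1 hε he hg hgr
  -- A frontier point is in the closure, so the envelope is an infimum over a nonempty set.
  have hne : ((Ω ∩ h ⁻¹' Ω₀) ∩ Metric.ball z r).Nonempty := by
    rw [inter_comm]
    exact mem_closure_iff.1 (frontier_subset_closure hzf) _ Metric.isOpen_ball
      (Metric.mem_ball_self hr)
  obtain ⟨g', hg', hgr'⟩ := exists_lipschitz_graph_of_cone
    (hh.smooth.continuousOn.isOpen_inter_preimage hΩ hΩ₀) hne he' κ' hcone
  exact ⟨r, e', κ', g', hr, he', hg', hgr'⟩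

end LipschitzBoundary

/-! ### Boundary Harnack inequality and conclusion. -/

namespace IsConjugate

variable {n : ℕ} {L L' : DiscreteOp n} {Ω' : Set (EuclideanSpace ℝ (Fin n))}
  {h k : EuclideanSpace ℝ (Fin n) → EuclideanSpace ℝ (Fin n)}
  {M : EuclideanSpace ℝ (Fin n) → ℝ}

/-- The inequality is applied to the preimages of `Ω₀`, `N`, `N'` and to the point `k x₀`. At this
fixed point the weight is just a number absorbed in the constant; only `1/M` on the compact set
`k(closure N')` needs a uniform bound. -/
theorem boundaryHarnack (hc : IsConjugate L L' Ω' M h k) (hη : L.η = volume.restrict L.Ω)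
    (hh : IsSmoothChange L.Ω Ω' h k) (hM : ContDiffOn ℝ ∞ M L.Ω) (hMpos : ∀ x ∈ L.Ω, 0 < M x)
    {zm : Prop} {s : ℝ} (hL : L.BoundaryHarnack zm s) : L'.BoundaryHarnack zm s := by
  intro Ω₀ N N' t₀ x₀ hΩ₀ hΩ₀Ω hN hNΩ hN' hN'c hN'N hne hLip ht₀ hx₀
  have hdom := hc.domain_eq
  rw [hdom] at hΩ₀Ω hNΩ
  have hN'Ω : N' ⊆ N := subset_closure.trans hN'N
  have hk : ∀ {O : Set (EuclideanSpace ℝ (Fin n))}, O ⊆ Ω' → ∀ y ∈ O, k y ∈ L.Ω ∩ h ⁻¹' O :=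
    fun hO y hy => ⟨hh.mapsTo_inv (hO hy), by rwa [mem_preimage, hh.invOn.2 (hO hy)]⟩
  have hcpt : IsCompact (k '' closure N') :=
    hN'c.image_of_continuousOn (hh.smooth_inv.continuousOn.mono (hN'N.trans hNΩ))
  have hsub : L.Ω ∩ h ⁻¹' N' ⊆ k '' closure N' := fun x hx =>
    ⟨h x, subset_closure hx.2, hh.invOn.1 hx.1⟩
  -- Compactness of `k(closure N')` makes it closed in all of `ℝⁿ`, so the closure of the preimage
  -- cannot reach the boundary of `Ω`.
  have hcl : closure (L.Ω ∩ h ⁻¹' N') ⊆ k '' closure N' := closure_minimal hsub hcpt.isClosed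
  have hclN : k '' closure N' ⊆ L.Ω ∩ h ⁻¹' N :=
    image_subset_iff.2 fun y hy => hk hNΩ y (hN'N hy)
  have hfr : (frontier (L.Ω ∩ h ⁻¹' Ω₀) ∩ (L.Ω ∩ h ⁻¹' N')).Nonempty := by
    obtain ⟨y, hyf, hyN⟩ := hne
    have hyΩ : y ∈ Ω' := hNΩ (hN'Ω hyN)
    -- With this identity `IsSmoothChange.mem_frontier`, applied to `k` instead of `h`, sends
    -- frontier points of `Ω₀` to frontier points of its preimage.
    have himg : Ω' ∩ k ⁻¹' (L.Ω ∩ h ⁻¹' Ω₀) = Ω₀ := by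
      ext w
      constructor
      · rintro ⟨hw, -, hw2⟩
        rwa [mem_preimage, hh.invOn.2 hw] at hw2
      · exact fun hw => ⟨hΩ₀Ω hw, hk hΩ₀Ω w hw⟩
    refine ⟨k y, (hh.symm L.isOpen).mem_frontier hh.isOpen
      (isOpen_preimage_inter hh L.isOpen hΩ₀) hyΩ (himg.symm ▸ hyf),
      hk (hN'Ω.trans hNΩ) y hyN⟩
  have hinter : ∀ O₁ O₂ : Set (EuclideanSpace ℝ (Fin n)),
      (L.Ω ∩ h ⁻¹' O₁) ∩ (L.Ω ∩ h ⁻¹' O₂) = L.Ω ∩ h ⁻¹' (O₁ ∩ O₂) := fun O₁ O₂ => by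
    rw [preimage_inter, ← inter_inter_distrib_left]
  have hx₀' := hk (inter_subset_left.trans hΩ₀Ω) x₀ hx₀
  obtain ⟨C, hC0, hC⟩ := hL (L.Ω ∩ h ⁻¹' Ω₀) (L.Ω ∩ h ⁻¹' N) (L.Ω ∩ h ⁻¹' N') t₀ (k x₀)
    (isOpen_preimage_inter hh L.isOpen hΩ₀) inter_subset_left
    (isOpen_preimage_inter hh L.isOpen hN) inter_subset_left
    (isOpen_preimage_inter hh L.isOpen hN') (hcpt.of_isClosed_subset isClosed_closure hcl)
    (hcl.trans hclN) hfr (hLip.preimage hh L.isOpen hΩ₀) ht₀ (by rw [hinter]; exact hx₀')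
  obtain ⟨A, hA0, hA⟩ := exists_weight_bound hcpt (hclN.trans inter_subset_left) hM.continuousOn
    hMpos
  have hMx₀ : 0 < M (k x₀) := hMpos _ hx₀'.1
  refine ⟨A * C * M (k x₀), by positivity, fun u hu hpos hcont hvan p hp => ?_⟩
  have hu0 : 0 ≤ u (t₀, x₀) := hpos.nonneg (O := N) isOpen_Ioo hN (fun t ht => ht.2)
    (hdom ▸ hNΩ) hcont ⟨⟨by linarith [ht₀.1], ht₀.2⟩, hx₀.2⟩
  have hsol := hc.isSolution_transfer_real hη hh hM hMpos hu
  rw [← hinter] at hsol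
  have hpΩ : p.2 ∈ Ω' := hΩ₀Ω hp.2.1
  have h1 := hC _ hsol (hc.nonnegBefore_transfer hη hh hM hMpos hpos)
    (continuousOn_transfer_real hh hM hcont)
    (fun q hq => by
      rw [hvan (q.1, h q.2) ⟨hq.1, hq.2.1.2, fun h0 => hq.2.2 ⟨hq.2.1.1, h0⟩⟩, mul_zero])
    (p.1, k p.2) ⟨hp.1, by
      rw [hinter]
      exact hk (inter_subset_left.trans hΩ₀Ω) p.2 hp.2⟩
  simp only [hh.invOn.2 hpΩ, hh.invOn.2 (hΩ₀Ω hx₀.1), Prod.mk.eta] at h1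
  have hMp : 0 < M (k p.2) := hMpos _ (hh.mapsTo_inv hpΩ)
  calc u p = (M (k p.2))⁻¹ * (M (k p.2) * u p) := by rw [inv_mul_cancel_left₀ hMp.ne']
    _ ≤ (M (k p.2))⁻¹ * (C * (M (k x₀) * u (t₀, x₀))) :=
        mul_le_mul_of_nonneg_left h1 (inv_nonneg.2 hMp.le)
    _ ≤ A * (C * (M (k x₀) * u (t₀, x₀))) :=
        mul_le_mul_of_nonneg_right (hA _ (mem_image_of_mem k (subset_closure hp.2.2))).2
          (by positivity)
    _ = A * C * M (k x₀) * u (t₀, x₀) := by ring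

end IsConjugate

theorem mainTheorem7 {n : ℕ} (L : DiscreteOp n) (Λ : ℝ)
    (a : EuclideanSpace ℝ (Fin n) → Matrix (Fin n) (Fin n) ℝ)
    (c : EuclideanSpace ℝ (Fin n) → ℝ) (hL : IsDivergenceForm L Λ a c)
    (Ω' : Set (EuclideanSpace ℝ (Fin n)))
    (h k : EuclideanSpace ℝ (Fin n) → EuclideanSpace ℝ (Fin n))
    (hh : IsSmoothChange L.Ω Ω' h k)
    (M : EuclideanSpace ℝ (Fin n) → ℝ) (hM : ContDiffOn ℝ ∞ M L.Ω) (hMpos : ∀ x ∈ L.Ω, 0 < M x) :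
    -- the conjugated operator exists, with eigenvalues `λ_j` and eigenfunctions `φ_j(h⁻¹)/M(h⁻¹)`
    (∃ L' : DiscreteOp n, IsConjugate L L' Ω' M h k ∧ L'.eigval = L.eigval ∧
      ∀ j, ∀ y ∈ Ω', L'.eigfun j y = (M (k y))⁻¹ * L.eigfun j (k y)) ∧
    -- and for every spectral resolution `L'` of the conjugated operator:
    ∀ L' : DiscreteOp n, IsConjugate L L' Ω' M h k →
      -- `U ∘ W` is an isometry of the `L²` spaces on space-time
      (∀ u, MemLp u 2 L'.stMeasure ↔ MemLp (transferT M h u) 2 L.stMeasure) ∧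
      (∀ u, MemLp u 2 L'.stMeasure →
        eLpNorm (transferT M h u) 2 L.stMeasure = eLpNorm u 2 L'.stMeasure) ∧
      -- `(∂_t + L')^s = (U ∘ W)⁻¹ (∂_t + L)^s (U ∘ W)`
      (∀ s ∈ Icc (0 : ℝ) 1,
        (∀ u, L'.MemDomH s u ↔ L.MemDomH s (transferT M h u)) ∧
        ∀ u v, L'.MemDomH s u → L'.MemDomH s v →
          L'.pairH s u v = L.pairH s (transferT M h u) (transferT M h v)) ∧
      -- transference of the estimates
      ∀ s ∈ Ioo (0 : ℝ) 1, ∀ zm : Prop,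
        (L.InteriorHarnack zm s → L'.InteriorHarnack zm s) ∧
        (∀ α ∈ Ioo (0 : ℝ) 1, L.InteriorHolder zm s α → L'.InteriorHolder zm s α) ∧
        (L.BoundaryHarnack zm s → L'.BoundaryHarnack zm s) := by
  have hη := hL.measure_eq
  have H := DiscreteOp.isWeightedChange hη hh hM hMpos
  refine ⟨⟨L.transferOp hh.isOpen H, ⟨rfl, rfl, fun f => DiscreteOp.transferOp_memDom_iff _ H f,
    fun f g _ _ => DiscreteOp.transferOp_form _ H f g⟩, rfl, fun _ _ _ => rfl⟩, fun L' hc => ?_⟩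
  refine ⟨hc.memLp_transferT_iff hη hh hM hMpos,
    fun u hu => hc.eLpNorm_transferT hη hh hM hMpos hu,
    fun s _ => ⟨hc.memDomH_iff hη hh hM hMpos s, fun u v hu hv => hc.pairH_eq hη hh hM hMpos s hu hv⟩,
    fun s _ zm => ⟨hc.interiorHarnack hη hh hM hMpos,
      fun α hα => hc.interiorHolder hη hh hM hMpos hα, hc.boundaryHarnack hη hh hM hMpos⟩⟩
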